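/- **Setting.** Let $N\ge 1$, $\mathcal S=\{1,\dots,N\}\cup\{\bar 1,\dots,\bar N\}$, $\operatorname{sg}(k)=1$, $\operatorname{sg}(\bar k)=-1$. Let $\Lambda$ be the shift $n\mapsto n+1$, acting on sequences of complex $N\times N$ matrices. For $s_a\in\mathbb Z$ with $\sum_{a}s_a=0$ and $t_{ja}\in\mathbb C$ ($a\in\mathcal S$, $j\ge1$) put $W_0=\sum_kE_{kk}\Lambda^{s_k}\exp(\sum_jt_{jk}\Lambda^j)$, $\bar W_0=\sum_kE_{kk}\Lambda^{-s_{\bar k}}\exp(\sum_jt_{j\bar k}\Lambda^{-j})$. The multi-component 2D Toda hierarchy is the factorization problem $S\,W_0\,g=\bar S\,\bar W_0$ with $g$ independent of $(s,t)$, $$S=1+\varphi_1(n)\Lambda^{-1}+\varphi_2(n)\Lambda^{-2}+\cdots,\qquad \bar S=\bar\varphi_0(n)+\bar\varphi_1(n)\Lambda+\cdots,\quad \bar\varphi_0(n)\text{ invertible}.$$ It is understood formally: $W=SW_0$ and $\bar W=\bar S\bar W_0$ have equal logarithmic derivatives $\partial W\cdot W^{-1}=\partial\bar W\cdot\bar W^{-1}$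 in all $t_{ja}$, and equal ratios $TW\cdot W^{-1}=T\bar W\cdot\bar W^{-1}$ for all shifts $T:(s_a,s_b)\mapsto(s_a+1,s_b-1)$. Let $\epsilon>0$ run through a set accumulating at $0$, let $n=n_\epsilon\in\mathbb Z$ with $\epsilon n_\epsilon\to n_0\in\mathbb R$ (so $n_0=0$ if $n_\epsilon$ is fixed), and for each $\epsilon$ let a solution be given in the slow variables $\epsilon s_a,\epsilon t_{ja}$. Denote these again by $s_a,t_{ja}$: now the $s_a$ are real with $\sum_as_a=0$, only finitely many $t_{ja}$ are non-zero, and $(s,t)$ ranges over a domain $D$ (open in every finite-dimensional affine slice). Assume that at $n=n_\epsilon$ the first row of the wave functions has the quasi-classical form $\Psi_a=\exp(\mathscr S_a/\epsilon)$; that is, with $w=z^{-\operatorname{sg}a}$, the power series $$1+\varphi_{1,11}w+\varphi_{2,11}w^2+\cdots\ (a=1),\qquad \varphi_{1,1k}+\varphi_{2,1k}w+\cdots\ (a=k\ne1),\qquad \bar\varphi_{0,1k}+\bar\varphi_{1,1k}w+\cdots\ (a=\bar k)$$ equal $\exp\big(\epsilon^{-1}\sum_{i\ge0}\mathscr S_a^{(i)}(\epsilon,s,t)w^i\big)$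 with $\mathscr S^{(0)}_1=0$, where each $\mathscr S_a^{(i)}(\epsilon,\cdot)$ is $C^1$ and converges as $\epsilon\to0$, with its first derivatives and locally uniformly (on finite-dimensional slices), to $\mathscr S^{(i)}_{a,0}(s,t)$. Put $$\mathscr S_{a,0}=(n_0+\operatorname{sg}(a)s_a)\log z+\sum_{j\ge1}t_{ja}z^{\operatorname{sg}(a)j}+\sum_{i\ge0}\mathscr S_{a,0}^{(i)}z^{-\operatorname{sg}(a)i},$$ a formal series at $w=0$. Write $\partial_{ja}=\partial/\partial t_{ja}$ and $\bar\partial_a=\partial_{s_a}-\partial_{s_{\bar1}}$ for $a\neq\bar1$; with the variables $\bar\sigma_a=s_a$ ($a\ne\bar1$) and $x:=\bar\sigma_1$ we have $\partial_x=\bar\partial_1$. **Proposition.** On $D$: 1. There are non-vanishing functions $r_a$ ($a\ne\bar1$) of $(s,t)$ such that for all $b\in\mathcal S$ $$\partial_{1\bar1}\mathscr S_{b,0}=r_1e^{-\bar\partial_1\mathscr S_{b,0}}=r_a\big(e^{-\bar\partial_a\mathscr S_{b,0}}-1\big)\qquad(a\neq1,\bar1).$$ Put $\rho_a=r_1/r_a$,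 and $Z_1=p$, $Z_{\bar1}=p^{-1}$, $Z_a=\dfrac{p}{p+\rho_a}$ for $a\ne1,\bar1$. Then $e^{\bar\partial_a\mathscr S_{b,0}}=\dfrac{P}{P+\rho_a}$ with $P=e^{\partial_x\mathscr S_{b,0}}$, for all $b$ and all $a\neq1,\bar1$. 2. For each $a$ the implicit relation $\partial_x\mathscr S_{a,0}|_{z=z_a}=\log p$ has a unique formal solution $z_a(p)$ at the puncture $p=\infty$ ($a=1$), $p=0$ ($a=\bar1$), $p=-\rho_a$ ($a\ne1,\bar1$), with $z_a^{-\operatorname{sg}a}$ a power series vanishing there in the local parameter $1/p$, $p$, $p+\rho_a$, respectively (dispersionless Lax functions). It has the form $$z_a^{\operatorname{sg}a}=\bar\ell_{a,1}Z_a+\bar\ell_{a,0}+\sum_{j\ge1}\bar\ell_{a,-j}Z_a^{-j},\qquad \bar\ell_{a,1}\neq0,\quad\bar\ell_{1,1}=1 .$$ 3. The dispersionless Orlov–Schulman functions $m_a:=z\,\partial\mathscr S_{a,0}/\partial z|_{z=z_a}$ have the form $$m_a=n_0+\operatorname{sg}(a)\Big(s_a+\sum_{j\ge1}jt_{ja}z_a^{\operatorname{sg}(a)j}\Big)+\sum_{j\ge1}\mu_{aj}Z_a^{-j}.$$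 4. For all $a,b\in\mathcal S$, $j\geq1$: $\partial_{ja}\mathscr S_{b,0}|_{z=z_b}=\Omega_{ja}(p)$ where, if $z_a^{\operatorname{sg}(a)j}=\sum_{i\le j}c_iZ_a^i$, then $\Omega_{j1}=\sum_{i=0}^jc_ip^i$, $\Omega_{j\bar1}=\sum_{i=1}^jc_ip^{-i}$, and $\Omega_{ja}=\sum_{i=1}^jc_i(Z_a^i-1)$ for $a\ne1,\bar1$. Together with 1 and 2, $$d\mathscr S_{b,0}=m_b\,d\log z_b+\log p\,dx+\sum_{a\neq1,\bar1}\log\frac{p}{p+\rho_a}\,ds_a+\sum_{j\ge1,\,a\in\mathcal S}\Omega_{ja}\,dt_{ja}.$$ 5. The $\mathscr S_{b,0}$ give a solution of the zero-genus Whitham hierarchy with $2N$ punctures in the Toda picture: the punctures $q_1=\infty$, $q_{\bar1}=0$, $q_a=-\rho_a$ ($a\neq1,\bar1$) are distinct, $z_a^{\operatorname{sg}a}$ has a simple pole at $q_a$ (equal to $p+O(1)$ for $a=1$), and, with $t_{0a}=s_a$ for $a\ne1$ (so $\partial/\partial t_{0a}=\partial_{s_a}-\partial_{s_1}$), for all $b\in\mathcal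 S$ $$\partial_{t_{0a}}\mathscr S_{b,0}|_{z=z_b}=-\log(p-q_a)\ (a\ne1),\qquad \partial_{t_{ja}}\mathscr S_{b,0}|_{z=z_b}=\big(z_a^{\operatorname{sg}(a)j}\big)_{(a,+)}\ (j\ge1,\ a\in\mathcal S),$$ where $(\cdot)_{(a,+)}$ is the projection to the span of $p^i$, $i\ge0$, for $a=1$ and of $(p-q_a)^{-i}$, $i\geq1$, for $a\neq1$, in the expansion at the puncture $q_a$. Equations between logarithms are understood after exponentiation. -/

import Mathlib

open Filter Topology

namespace TodaWhitham

noncomputable section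

/-! ### Indices, slow variables -/

/-- The index set `𝒮 = {1, …, N} ∪ {1̄, …, N̄}`; `inl k` is an unbarred index, `inr k` a barred one. -/
abbrev Idx (N : ℕ) := Fin N ⊕ Fin N

/-- `sg a = 1` for an unbarred index and `-1` for a barred one. -/
def sg {N : ℕ} : Idx N → ℤ
  | Sum.inl _ => 1
  | Sum.inr _ => -1

/-- The index `1`. -/
def one (N : ℕ) [NeZero N] : Idx N := Sum.inl 0

/-- The index `1̄`. -/
def oneBar (N : ℕ) [NeZero N] : Idx N := Sum.inr 0

/-- Slow variables `(s, t)`: real `s_a`, and complex times `t_{ja}` (`j ≥ 1`), finitely many of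
which are nonzero. -/
abbrev Point (N : ℕ) := (Idx N → ℝ) × ((ℕ+ × Idx N) →₀ ℂ)

/-- The total charge `|s| = ∑ s_a`. -/
def charge {N : ℕ} (x : Point N) : ℝ := ∑ a, x.1 a

/-- The integer direction `e_a - e_b` in the variables `s`. -/
def hop {N : ℕ} (a b : Idx N) : Idx N → ℤ := Pi.single a 1 - Pi.single b 1

/-- An integer direction in the variables `s`, as a displacement of the slow variables. -/
def sDir {N : ℕ} (v : Idx N → ℤ) : Point N := (fun a => (v a : ℝ), 0)

/-- The displacement of the time `t_{ja}` by `τ`. -/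
def tDir {N : ℕ} (j : ℕ+) (a : Idx N) (τ : ℂ) : Point N := (0, Finsupp.single (j, a) τ)

/-- The affine slice `τ ↦ x + ∑ i, τ_i d_i` of the space of slow variables. -/
def slice {N m : ℕ} (x : Point N) (d : Fin m → Point N) (τ : Fin m → ℝ) : Point N :=
  x + ∑ i, τ i • d i

/-- A domain in the zero charge sector: all points have zero charge, and the intersection with every
finite-dimensional affine slice of the zero charge sector is open. -/
structure IsDomainZeroCharge {N : ℕ} (D : Set (Point N)) : Prop where
  charge_eq : ∀ x ∈ D, charge x = 0
  isOpen_slice : ∀ (x : Point N) (m : ℕ) (d : Fin m → Point N), charge x = 0 →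
    (∀ i, charge (d i) = 0) → IsOpen {τ : Fin m → ℝ | slice x d τ ∈ D}

/-! ### Operators in the shift `Λ` and the factorization problem -/

/-- A (formal, possibly two-sided) series `∑_j X_j(n) Λ^j` with matrix coefficients:
`X j n` is `X_j(n)`. -/
abbrev Op (N : ℕ) := ℤ → ℤ → Matrix (Fin N) (Fin N) ℂ

/-- A finite sum `∑_j X_j(n) Λ^j`. -/
abbrev BandOp (N : ℕ) := ℤ →₀ (ℤ → Matrix (Fin N) (Fin N) ℂ)

/-- The product `X · Y`, with `(X(n) Λ^i) (Y(n) Λ^j) = X(n) Y(n+i) Λ^(i+j)`, for finite `X`. -/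
def BandOp.mul {N : ℕ} (X : BandOp N) (Y : Op N) : Op N :=
  fun m n => X.sum fun i c => c n * Y (m - i) (n + i)

/-- The product `Y · ∑_k E_{kk} Λ^{d_k}`. -/
def mulDiagShift {N : ℕ} (Y : Op N) (d : Fin N → ℤ) : Op N :=
  fun m n => Matrix.of fun r k => Y (m - d k) n r k

/-- The product `Y · E_{kk} Λ^j`. -/
def mulUnitShift {N : ℕ} (Y : Op N) (k : Fin N) (j : ℤ) : Op N :=
  fun m n => Y (m - j) n * Matrix.single k k 1

/-- `S ∈ G_-`, i.e. `S = 1 + φ_1(n) Λ^{-1} + φ_2(n) Λ^{-2} + ⋯`. -/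
def IsGMinus {N : ℕ} (S : Op N) : Prop :=
  (∀ n, S 0 n = 1) ∧ ∀ j n, 0 < j → S j n = 0

/-- `S̄ ∈ G_+`, i.e. `S̄ = φ̄_0(n) + φ̄_1(n) Λ + ⋯` is invertible. -/
def IsGPlus {N : ℕ} (Sb : Op N) : Prop :=
  (∀ n, IsUnit (Sb 0 n)) ∧ ∀ j n, j < 0 → Sb j n = 0

/-- `S · (∂ W_0 / ∂ t_{ja}) W_0⁻¹` (fast time), where
`W_0 = ∑_k E_{kk} Λ^{s_k} exp (∑_j t_{jk} Λ^j)`. -/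
def dressW {N : ℕ} (S : Op N) (j : ℕ+) : Idx N → Op N
  | Sum.inl k => mulUnitShift S k (j : ℤ)
  | Sum.inr _ => 0

/-- `S̄ · (∂ W̄_0 / ∂ t_{ja}) W̄_0⁻¹` (fast time), where
`W̄_0 = ∑_k E_{kk} Λ^{-s_{k̄}} exp (∑_j t_{jk̄} Λ^{-j})`. -/
def dressWBar {N : ℕ} (Sb : Op N) (j : ℕ+) : Idx N → Op N
  | Sum.inl _ => 0
  | Sum.inr k => mulUnitShift Sb k (-(j : ℤ))

/-- The factorization problem `S W_0 g = S̄ W̄_0`, `S ∈ G_-`, `S̄ ∈ G_+`, of the multi-component 2D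
Toda hierarchy, written in the slow variables `ε s_a`, `ε t_{ja}`.

With `W = S W_0` and `W̄ = S̄ W̄_0` the problem says that the operator `g = W⁻¹ W̄` does not depend on
the deformation parameters. As the products defining `g` are two-sided formal series, this is
expressed, as usual, by the equality of the logarithmic derivatives and differences
`∂W · W⁻¹ = ∂W̄ · W̄⁻¹` and `(T W) · W⁻¹ = (T W̄) · W̄⁻¹`, where `T` ranges over the charge preserving
shifts `s_a ↦ s_a + 1`, `s_b ↦ s_b - 1`. In each equality the left-hand side has powers of `Λ`
bounded above and the right-hand side powers bounded below, so that their common value (`B`, resp.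
`X`) is a finite sum. -/
structure IsTodaSolution {N : ℕ} (ε : ℝ) (D : Set (Point N)) (S Sb : Point N → Op N) : Prop where
  minus : ∀ x ∈ D, IsGMinus (S x)
  plus : ∀ x ∈ D, IsGPlus (Sb x)
  shift : ∀ x ∈ D, ∀ a b : Idx N, x + ε • sDir (hop a b) ∈ D → ∃ X : BandOp N,
    mulDiagShift (S (x + ε • sDir (hop a b))) (fun k => hop a b (Sum.inl k)) = X.mul (S x) ∧
    mulDiagShift (Sb (x + ε • sDir (hop a b))) (fun k => -hop a b (Sum.inr k)) = X.mul (Sb x)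
  flow : ∀ x ∈ D, ∀ (j : ℕ+) (a : Idx N), ∃ B : BandOp N, ∀ (m n : ℤ) (r c : Fin N),
    HasDerivAt (fun τ : ℂ => S (x + tDir j a τ) m n r c)
      ((ε : ℂ)⁻¹ * (B.mul (S x) m n r c - dressW (S x) j a m n r c)) 0 ∧
    HasDerivAt (fun τ : ℂ => Sb (x + tDir j a τ) m n r c)
      ((ε : ℂ)⁻¹ * (B.mul (Sb x) m n r c - dressWBar (Sb x) j a m n r c)) 0

/-! ### The quasi-classical form of the first row of the wave functions

The local coordinate at the puncture with index `a` is `w = z^{- sg a}`: `w = 1/z` for unbarred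
indices (`z → ∞`) and `w = z` for barred ones (`z → 0`). -/

/-- The amplitude of the wave function `Ψ_a`, as a power series in `w = z^{- sg a}`:
`1 + φ_{1,11} w + ⋯` for `a = 1`, `φ_{1,1k} + φ_{2,1k} w + ⋯` for `a = k ≠ 1`, and
`φ̄_{0,1k} + φ̄_{1,1k} w + ⋯` for `a = k̄`. Thus `Ψ_a` is its product with
`z^(n + s_1)`, `z^(n + s_k - 1)`, `z^(n - s_{k̄})`, respectively, and with `exp (∑_j t_{ja} w^{-j})`. -/
def amplitude {N : ℕ} [NeZero N] (S Sb : Op N) (n : ℤ) : Idx N → PowerSeries ℂ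
  | Sum.inl k => PowerSeries.mk fun i =>
      if k = 0 then S (-(i : ℤ)) n 0 k else S (-((i : ℤ) + 1)) n 0 k
  | Sum.inr k => PowerSeries.mk fun i => Sb (i : ℤ) n 0 k

/-- The exponential of a power series with arbitrary constant term. -/
def expSeries (F : PowerSeries ℂ) : PowerSeries ℂ :=
  PowerSeries.C (Complex.exp (PowerSeries.constantCoeff F)) *
    (PowerSeries.exp ℂ).subst (F - PowerSeries.C (PowerSeries.constantCoeff F))

/-- The quasi-classical form `Ψ_a = exp (𝒮_a / ε)` of the wave functions (the first row, at the value
`n ε` of the discrete variable) for `ε ∈ E`. Besides the explicit terms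
`(ε n + sg a s_a) log z + ∑_j t_{ja} z^{sg a j}` (and `-ε log z` for `a = k ≠ 1`), the function
`𝒮_a` has the coefficients `act a i ε` of `w^i`, and these converge together with their first
derivatives, locally uniformly on finite-dimensional slices, to the coefficients `act₀ a i` of
`𝒮_{a,0}` as `ε → 0`. -/
structure IsQuasiClassical {N : ℕ} [NeZero N] (E : Set ℝ) (D : Set (Point N)) (n : ℝ → ℤ)
    (S Sb : ℝ → Point N → Op N) (act : Idx N → ℕ → ℝ → Point N → ℂ)
    (act₀ : Idx N → ℕ → Point N → ℂ) : Prop where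
  wave : ∀ ε ∈ E, ∀ x ∈ D, ∀ a, amplitude (S ε x) (Sb ε x) (n ε) a =
    expSeries (PowerSeries.mk fun i => act a i ε x / (ε : ℂ))
  normalized : ∀ ε ∈ E, ∀ x ∈ D, act (one N) 0 ε x = 0
  contDiffOn : ∀ ε ∈ E, ∀ (a : Idx N) (i : ℕ) (x : Point N) (m : ℕ) (d : Fin m → Point N),
    charge x = 0 → (∀ l, charge (d l) = 0) →
    ContDiffOn ℝ 1 (fun τ => act a i ε (slice x d τ)) {τ | slice x d τ ∈ D}
  contDiffOn_limit : ∀ (a : Idx N) (i : ℕ) (x : Point N) (m : ℕ) (d : Fin m → Point N),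
    charge x = 0 → (∀ l, charge (d l) = 0) →
    ContDiffOn ℝ 1 (fun τ => act₀ a i (slice x d τ)) {τ | slice x d τ ∈ D}
  tendsto : ∀ (a : Idx N) (i : ℕ) (x : Point N) (m : ℕ) (d : Fin m → Point N),
    charge x = 0 → (∀ l, charge (d l) = 0) →
    TendstoLocallyUniformlyOn (fun ε τ => act a i ε (slice x d τ))
      (fun τ => act₀ a i (slice x d τ)) (𝓝[E] 0) {τ | slice x d τ ∈ D}
  tendsto_fderiv : ∀ (a : Idx N) (i : ℕ) (x : Point N) (m : ℕ) (d : Fin m → Point N),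
    charge x = 0 → (∀ l, charge (d l) = 0) →
    TendstoLocallyUniformlyOn (fun ε τ => fderiv ℝ (fun τ' => act a i ε (slice x d τ')) τ)
      (fun τ => fderiv ℝ (fun τ' => act₀ a i (slice x d τ')) τ) (𝓝[E] 0) {τ | slice x d τ ∈ D}

/-! ### Laurent series in a local coordinate -/

/-- A power series as a Laurent series. -/
abbrev toL (f : PowerSeries ℂ) : LaurentSeries ℂ := HahnSeries.ofPowerSeries ℤ ℂ f

/-- A constant Laurent series. -/
abbrev cst (c : ℂ) : LaurentSeries ℂ := HahnSeries.C c

/-- The composition `F ∘ f` of a Laurent series `F` with a power series `f` without constant term: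
if `F = w^o G(w)` with `o` the order of `F`, it is `f^o G(f)`. -/
def compL (F : LaurentSeries ℂ) (f : PowerSeries ℂ) : LaurentSeries ℂ :=
  toL f ^ F.order * toL (F.powerSeriesPart.subst f)

/-! ### The dispersionless functions

`𝒮_{a,0} = (n₀ + sg a s_a) log z + ∑_{j ≥ 1} t_{ja} z^{sg a j} + ∑_{i ≥ 0} act₀ a i w^i`,
`w = z^{- sg a}`. -/

/-- The part of `𝒮_{a,0}` without `log z`, as a Laurent series in `w = z^{- sg a}`. -/
def actionL {N : ℕ} (act₀ : Idx N → ℕ → Point N → ℂ) (a : Idx N) (x : Point N) :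
    LaurentSeries ℂ :=
  (x.2.sum fun ja c => if ja.2 = a then HahnSeries.single (-(ja.1 : ℤ)) c else 0) +
    toL (PowerSeries.mk fun i => act₀ a i x)

/-- `z ∂𝒮_{a,0}/∂z` as a Laurent series in `w = z^{- sg a}`; note that
`z ∂/∂z = - sg a w ∂/∂w`. -/
def zDerivAction {N : ℕ} (act₀ : Idx N → ℕ → Point N → ℂ) (n₀ : ℝ) (a : Idx N) (x : Point N) :
    LaurentSeries ℂ :=
  cst ((n₀ + sg a * x.1 a : ℝ) : ℂ) -
    cst (sg a : ℂ) *
      (HahnSeries.single (1 : ℤ) (1 : ℂ) * LaurentSeries.hasseDeriv ℂ 1 (actionL act₀ a x))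

/-- `exp (∂_v 𝒮_{a,0})` as a Laurent series in `w = z^{- sg a}`, where `∂_v` is the derivative along
the integer direction `v` in the variables `s` (at fixed `z` and `t`). The factor `w^{-v_a}` comes
from `sg a s_a log z = - s_a log w`. -/
def expDeriv {N : ℕ} (act₀ : Idx N → ℕ → Point N → ℂ) (v : Idx N → ℤ) (a : Idx N) (x : Point N) :
    LaurentSeries ℂ :=
  HahnSeries.single (-v a) (1 : ℂ) *
    toL (expSeries (PowerSeries.mk fun i => lineDeriv ℝ (act₀ a i) x (sDir v)))

/-- `F` is the derivative of the family `L` of Laurent series with respect to `t_{ja}` at `x`. -/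
def HasTimeDeriv {N : ℕ} (L : Point N → LaurentSeries ℂ) (F : LaurentSeries ℂ) (j : ℕ+)
    (a : Idx N) (x : Point N) : Prop :=
  ∀ i : ℤ, HasDerivAt (fun τ : ℂ => (L (x + tDir j a τ)).coeff i) (F.coeff i) 0

/-- The coordinate `p` of the sphere as a Laurent series in the local parameter `ζ` at the puncture
with index `a`: `ζ = 1/p` at the puncture `p = ∞` (index `1`), and `ζ = p - q` at a finite puncture
`p = q`. -/
def pLocal {N : ℕ} [NeZero N] (a : Idx N) (q : ℂ) : LaurentSeries ℂ :=
  if a = one N then HahnSeries.single (-1 : ℤ) (1 : ℂ)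
  else cst q + HahnSeries.single (1 : ℤ) (1 : ℂ)

/-- The position `q_a` of the puncture: `0` for `a = 1̄`, and `-ρ_a` for `a ≠ 1, 1̄`
(the puncture with index `1` is at `p = ∞`). -/
def puncture {N : ℕ} [NeZero N] (ρ : Idx N → ℂ) (a : Idx N) : ℂ :=
  if a = oneBar N then 0 else -ρ a

/-- `Z_a`, that is `p` for `a = 1`, `1/p` for `a = 1̄`, and `p/(p + ρ_a)` otherwise, for
`p` in the field of Laurent series. -/
def zFun {N : ℕ} [NeZero N] (ρ : Idx N → ℂ) (a : Idx N) (p : LaurentSeries ℂ) : LaurentSeries ℂ :=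
  if a = one N then p else if a = oneBar N then p⁻¹ else p / (p + cst (ρ a))

/-- `1/Z_a` as a power series in the local parameter `ζ` at the puncture with index `a`: it is `ζ`
for `a = 1, 1̄`, and `(p + ρ_a)/p = ζ/(ζ - ρ_a)` otherwise. -/
def zInv {N : ℕ} [NeZero N] (ρ : Idx N → ℂ) (a : Idx N) : PowerSeries ℂ :=
  if a = one N ∨ a = oneBar N then PowerSeries.X
  else PowerSeries.X * (PowerSeries.X - PowerSeries.C (ρ a))⁻¹

/-- The dispersionless Lax function `z_a`, through the power series `f = z_a^{- sg a}` in the local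
parameter at the puncture with index `a`: it vanishes at the puncture, and
`∂_x 𝒮_{a,0} |_{z = z_a} = log p`, where `∂_x = ∂_{s_1} - ∂_{s_{1̄}}`. -/
def IsLaxFunction {N : ℕ} [NeZero N] (act₀ : Idx N → ℕ → Point N → ℂ) (ρ : Idx N → ℂ)
    (a : Idx N) (x : Point N) (f : PowerSeries ℂ) : Prop :=
  PowerSeries.constantCoeff f = 0 ∧
    compL (expDeriv act₀ (hop (one N) (oneBar N)) a x) f = pLocal a (puncture ρ a)

/-! ### The zero-genus Whitham hierarchy in the Toda picture -/

/-- `Ω_{jb} = (z_b^j)_{(b,+)}` evaluated at `p`, where `f = 1/z_b` as a power series in the local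
parameter at the puncture with index `b`: the part of `z_b^j` in the span of `p^i`, `i ≥ 0`, for
`b = 1`, and in the span of `(p - q_b)^{-i}`, `i ≥ 1`, for `b ≠ 1`. -/
def whithamOmega {N : ℕ} [NeZero N] (b : Idx N) (q : ℂ) (f : PowerSeries ℂ) (j : ℕ+)
    (p : LaurentSeries ℂ) : LaurentSeries ℂ :=
  if b = one N then
    ∑ i ∈ Finset.range ((j : ℕ) + 1), cst ((toL f ^ (-(j : ℤ))).coeff (-(i : ℤ))) * p ^ i
  else
    ∑ i ∈ Finset.Icc 1 (j : ℕ),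
      cst ((toL f ^ (-(j : ℤ))).coeff (-(i : ℤ))) * ((p - cst (q)) ^ i)⁻¹

/-- A solution of the zero-genus Whitham hierarchy in the Toda picture with the `2N` punctures indexed
by `Idx N` (the index `1` at `p = ∞`, and `a₀ = 1̄` at `p = 0`), over the domain `D`. The times are
`t_{ja}` (`j ≥ 1`) and `t_{0a} = s_a` (`a ≠ 1`, the variable `s_1` being eliminated by the zero
charge condition, so that `∂/∂t_{0a} = ∂_{s_a} - ∂_{s_1}`).
`loc a x` is `1/z_a` as a power series in the local parameter at the puncture `Q_a`, and the local
functions are `S_a = lam a x · log z_a + L a x` with `L a x` a Laurent series in `1/z_a`.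
In `flow`, the series `p` is the inverse function `p = p(t, z_a)` of the local coordinate, and the
equations are `∂S_a/∂t_{jb} = Ω_{jb}(p)` and `∂S_a/∂t_{0b} = -log (p - q_b)`, the second one being
exponentiated; for `b = 1̄` it is the equation for `Ω_{A_0} = -log p`, with `x = -t_{0,1̄}`. -/
structure IsWhithamToda {N : ℕ} [NeZero N] (D : Set (Point N)) (q : Idx N → Point N → ℂ)
    (loc : Idx N → Point N → PowerSeries ℂ) (lam : Idx N → Point N → ℂ)
    (L : Idx N → Point N → LaurentSeries ℂ) : Prop where
  puncture_zero : ∀ x ∈ D, q (oneBar N) x = 0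
  puncture_ne : ∀ x ∈ D, ∀ a b, a ≠ one N → b ≠ one N → a ≠ b → q a x ≠ q b x
  loc_zero : ∀ x ∈ D, ∀ a, PowerSeries.constantCoeff (loc a x) = 0
  loc_ne : ∀ x ∈ D, ∀ a, PowerSeries.coeff 1 (loc a x) ≠ 0
  loc_one : ∀ x ∈ D, PowerSeries.coeff 1 (loc (one N) x) = 1
  flow : ∀ x ∈ D, ∀ a, ∃ p : LaurentSeries ℂ, compL p (loc a x) = pLocal a (q a x) ∧
    (∀ (j : ℕ+) (b : Idx N), HasDerivAt (fun τ : ℂ => lam a (x + tDir j b τ)) 0 0 ∧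
      HasTimeDeriv (L a) (whithamOmega b (q b x) (loc b x) j p) j b x) ∧
    ∀ b, b ≠ one N → ∃ (c : ℤ) (F : PowerSeries ℂ),
      HasLineDerivAt ℝ (lam a) (c : ℂ) x (sDir (hop b (one N))) ∧
      (∀ i : ℤ, HasLineDerivAt ℝ (fun y => (L a y).coeff i) ((toL F).coeff i) x
        (sDir (hop b (one N)))) ∧
      HahnSeries.single (-c) (1 : ℂ) * toL (expSeries F) = (p - cst (q b x))⁻¹

end

end TodaWhitham

namespace TodaWhitham
noncomputable section

/-! ### The exponential of a power series -/

/-! Fix `ε` and consider all first rows at `n` of pairs `(A·S, A·S̄)`, with `A` a finite operator in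
`Λ`; this is `LinearMap.range (rowMap S Sb n)`. The factorization problem enters only through this
space. It contains the row of the wave functions, the rows shifted in `s`, and `ε` times the
fast-time logarithmic flow of the row, because the shift and flow equations express all of these as
one finite operator acting on both halves. By triangularity of `S` and invertibility of the leading
term of `S̄`, an element with no nonnegative powers of `Λ` in the unbarred half and no negative ones
in the barred half is zero (`eq_zero_of_mem_range_rowMap`).

Divide by `Ψ_b`. The time derivative of the row becomes `∂_{ja}𝒮_b`, whose only pole is `w^{-j}` at
`b = a`. The `k`-fold shift in the direction `e_a - e_{a'}` becomes the exponential of a difference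
quotient, with a pole of order exactly `k` at `a` and no pole elsewhere. Removing the pole at `a`
and then the constant term at the index `1` leaves zero. So `∂_{ja}𝒮_b` is a combination of these
ratios and a constant, with coefficients that do not depend on `b` (`timeDeriv_eq_sum`). As `ε → 0`
the difference quotients tend to derivatives, and the coefficients converge because they solve a
triangular system whose limiting diagonal does not vanish. Hence `∂_{ja}𝒮_{b,0}` is a polynomial in
`exp((∂_{s_a} - ∂_{s_{a'}})𝒮_{b,0})`, the same polynomial for every `b` (`exists_timeDeriv_eq`). Its
constant term is fixed by the normalization of `𝒮_1`.

The rest is algebra. The time `t_{1,1̄}`, treated with `a' = 1` and with every other `a'`, gives two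
expressions for one function. Comparing them yields `exp((∂_{s_1} - ∂_{s_a})𝒮_b) = P + ρ_a`
(`exists_isPunctureData`). At `b = a` this has a simple zero in `w`, so it inverts to a unique Lax
function (`exists_lax`); at `a = 1` the series `1/P` plays that role. Substituting the Lax function
into the polynomial relation at `b = a` identifies its coefficients with the polar part of the power
of the Lax function (`exists_projection`). The Whitham form only replaces `Z_a` by `(p - q_a)⁻¹`, in
which `Z_a` is affine (`whithamOmega_eq`). -/

theorem hasSubst_sub_constantCoeff (F : PowerSeries ℂ) :
    PowerSeries.HasSubst (F - PowerSeries.C (PowerSeries.constantCoeff F)) :=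
  PowerSeries.HasSubst.of_constantCoeff_zero' (by simp)

theorem constantCoeff_subst_of_zero {f : PowerSeries ℂ} (hf : PowerSeries.constantCoeff f = 0)
    (g : PowerSeries ℂ) :
    PowerSeries.constantCoeff (g.subst f : PowerSeries ℂ) = PowerSeries.constantCoeff g := by
  have h1 : (g - PowerSeries.C (PowerSeries.constantCoeff g)) +
      PowerSeries.C (PowerSeries.constantCoeff g) = g := by ring
  have h0 := PowerSeries.constantCoeff_subst_eq_zero (a := f) hf
    (g - PowerSeries.C (PowerSeries.constantCoeff g)) (by simp)
  conv_lhs => rw [← h1]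
  rw [PowerSeries.subst_add (PowerSeries.HasSubst.of_constantCoeff_zero' hf), map_add,
    PowerSeries.subst_C]
  change MvPowerSeries.constantCoeff _ +
    PowerSeries.constantCoeff (PowerSeries.C (PowerSeries.constantCoeff g)) = _
  rw [h0]
  simp

theorem constantCoeff_expSeries (F : PowerSeries ℂ) :
    PowerSeries.constantCoeff (expSeries F) = Complex.exp (PowerSeries.constantCoeff F) := by
  rw [expSeries, map_mul, constantCoeff_subst_of_zero (by simp)]
  simp

theorem derivative_expSeries (F : PowerSeries ℂ) :
    PowerSeries.derivative ℂ (expSeries F) = PowerSeries.derivative ℂ F * expSeries F := by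
  have h := PowerSeries.derivative_subst (f := PowerSeries.exp ℂ) (hasSubst_sub_constantCoeff F)
  rw [PowerSeries.derivative_exp] at h
  rw [expSeries, Derivation.leibniz, h]
  simp only [map_sub, PowerSeries.derivative_C, smul_eq_mul]
  ring

/-- A first-order linear equation determines the coefficient of degree `n + 1` from the lower ones,
as `n + 1` is invertible in `ℂ`. Exponentials can thus be recognized by constant term and
logarithmic derivative, without expanding substitutions. -/
theorem eq_of_derivative_eq {A B G H : PowerSeries ℂ}
    (h0 : PowerSeries.constantCoeff A = PowerSeries.constantCoeff B)
    (hA : PowerSeries.derivative ℂ A = G * A + H)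
    (hB : PowerSeries.derivative ℂ B = G * B + H) : A = B := by
  ext n
  induction n using Nat.strong_induction_on with
  | _ n ih =>
    cases n with
    | zero => simpa using h0
    | succ n =>
      have h1 := congrArg (PowerSeries.coeff n) hA
      have h2 := congrArg (PowerSeries.coeff n) hB
      rw [PowerSeries.coeff_derivative, map_add, PowerSeries.coeff_mul] at h1 h2
      have h3 : ∑ p ∈ Finset.HasAntidiagonal.antidiagonal n,
          PowerSeries.coeff p.1 G * PowerSeries.coeff p.2 A =
          ∑ p ∈ Finset.HasAntidiagonal.antidiagonal n,
            PowerSeries.coeff p.1 G * PowerSeries.coeff p.2 B := by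
        refine Finset.sum_congr rfl fun p hp => ?_
        rw [ih p.2 (by have := Finset.HasAntidiagonal.mem_antidiagonal.1 hp; omega)]
      rw [h3, ← h2] at h1
      exact mul_right_cancel₀ (by exact_mod_cast Nat.succ_ne_zero n) h1

theorem eq_expSeries {A F : PowerSeries ℂ}
    (h0 : PowerSeries.constantCoeff A = Complex.exp (PowerSeries.constantCoeff F))
    (hA : PowerSeries.derivative ℂ A = PowerSeries.derivative ℂ F * A) : A = expSeries F :=
  eq_of_derivative_eq (H := 0) (h0.trans (constantCoeff_expSeries F).symm) (by rw [hA, add_zero])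
    (by rw [derivative_expSeries, add_zero])

theorem expSeries_add (F G : PowerSeries ℂ) :
    expSeries (F + G) = expSeries F * expSeries G := by
  symm
  refine eq_expSeries ?_ ?_
  · simp [constantCoeff_expSeries, Complex.exp_add]
  · rw [Derivation.leibniz, derivative_expSeries, derivative_expSeries, map_add, smul_eq_mul,
      smul_eq_mul]
    ring

theorem expSeries_zero : expSeries 0 = 1 := by
  symm
  refine eq_expSeries ?_ ?_
  · simp
  · simp

theorem expSeries_ne_zero (F : PowerSeries ℂ) : expSeries F ≠ 0 := by
  intro h
  have := constantCoeff_expSeries F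
  rw [h, map_zero] at this
  exact Complex.exp_ne_zero _ this.symm

/-- Compare coefficients in `E' = F' E`. The recursion is a finite polynomial expression, so limits
and derivatives of exponentials follow coefficient by coefficient, with no topology on power series.
-/
theorem coeff_succ_expSeries (F : PowerSeries ℂ) (n : ℕ) :
    PowerSeries.coeff (n + 1) (expSeries F) = ((n : ℂ) + 1)⁻¹ *
      ∑ p ∈ Finset.HasAntidiagonal.antidiagonal n, PowerSeries.coeff (p.1 + 1) F * ((p.1 : ℂ) + 1) *
        PowerSeries.coeff p.2 (expSeries F) := by
  have h1 := congrArg (PowerSeries.coeff n) (derivative_expSeries F)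
  rw [PowerSeries.coeff_derivative, PowerSeries.coeff_mul] at h1
  have h2 : ((n : ℂ) + 1) ≠ 0 := by exact_mod_cast Nat.succ_ne_zero n
  simp only [PowerSeries.coeff_derivative] at h1
  rw [← h1]
  field_simp

theorem tendsto_coeff_expSeries {ι : Type*} {l : Filter ι} {F : ι → PowerSeries ℂ}
    {G : PowerSeries ℂ}
    (h : ∀ i, Tendsto (fun t => PowerSeries.coeff i (F t)) l (𝓝 (PowerSeries.coeff i G))) (i : ℕ) :
    Tendsto (fun t => PowerSeries.coeff i (expSeries (F t))) l
      (𝓝 (PowerSeries.coeff i (expSeries G))) := by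
  induction i using Nat.strong_induction_on with
  | _ n ih =>
    cases n with
    | zero =>
      simp only [PowerSeries.coeff_zero_eq_constantCoeff, constantCoeff_expSeries]
      have := h 0
      simp only [PowerSeries.coeff_zero_eq_constantCoeff] at this
      exact (Complex.continuous_exp.tendsto _).comp this
    | succ n =>
      simp only [coeff_succ_expSeries]
      refine Tendsto.const_mul _ (tendsto_finsetSum _ fun p hp => ?_)
      exact ((h _).mul_const _).mul (ih p.2 (by
        have := Finset.HasAntidiagonal.mem_antidiagonal.1 hp
        omega))

theorem hasDerivAt_coeff_expSeries {F : ℝ → PowerSeries ℂ} {G : PowerSeries ℂ} {t : ℝ}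
    (h : ∀ i, HasDerivAt (fun t => PowerSeries.coeff i (F t)) (PowerSeries.coeff i G) t) (i : ℕ) :
    HasDerivAt (fun t => PowerSeries.coeff i (expSeries (F t)))
      (PowerSeries.coeff i (expSeries (F t) * G)) t := by
  induction i using Nat.strong_induction_on with
  | _ n ih =>
    cases n with
    | zero =>
      simp only [PowerSeries.coeff_zero_eq_constantCoeff, constantCoeff_expSeries, map_mul]
      have := h 0
      simp only [PowerSeries.coeff_zero_eq_constantCoeff] at this
      exact this.cexp
    | succ n =>
      simp only [coeff_succ_expSeries]
      -- The proposed derivative `E G` obeys the differentiated recursion, because `(E G)' = G' E +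
      -- F' (E G)`.
      have key : PowerSeries.coeff (n + 1) (expSeries (F t) * G) = ((n : ℂ) + 1)⁻¹ *
          ∑ p ∈ Finset.HasAntidiagonal.antidiagonal n,
            (PowerSeries.coeff (p.1 + 1) G * ((p.1 : ℂ) + 1) *
              PowerSeries.coeff p.2 (expSeries (F t)) +
             PowerSeries.coeff (p.1 + 1) (F t) * ((p.1 : ℂ) + 1) *
              PowerSeries.coeff p.2 (expSeries (F t) * G)) := by
        have h1 : PowerSeries.derivative ℂ (expSeries (F t) * G) =
            PowerSeries.derivative ℂ G * expSeries (F t) +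
              PowerSeries.derivative ℂ (F t) * (expSeries (F t) * G) := by
          rw [Derivation.leibniz, derivative_expSeries, smul_eq_mul, smul_eq_mul]
          ring
        have h2 := congrArg (PowerSeries.coeff n) h1
        have h3 : ((n : ℂ) + 1) ≠ 0 := by exact_mod_cast Nat.succ_ne_zero n
        rw [PowerSeries.coeff_derivative, map_add,
          PowerSeries.coeff_mul n (PowerSeries.derivative ℂ G),
          PowerSeries.coeff_mul n (PowerSeries.derivative ℂ (F t)),
          ← Finset.sum_add_distrib] at h2
        simp only [PowerSeries.coeff_derivative] at h2
        rw [← h2]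
        field_simp
      rw [key]
      refine HasDerivAt.const_mul _ (HasDerivAt.fun_sum fun p hp => ?_)
      exact ((h _).mul_const _).mul (ih p.2 (by
        have := Finset.HasAntidiagonal.mem_antidiagonal.1 hp
        omega))

/-! ### Laurent series and composition -/

theorem toL_zero : toL 0 = 0 := map_zero _
theorem toL_one : toL 1 = 1 := map_one _
theorem toL_add (f g : PowerSeries ℂ) : toL (f + g) = toL f + toL g := map_add _ _ _
theorem toL_sub (f g : PowerSeries ℂ) : toL (f - g) = toL f - toL g := map_sub _ _ _
theorem toL_mul (f g : PowerSeries ℂ) : toL (f * g) = toL f * toL g := map_mul _ _ _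
theorem toL_pow (f : PowerSeries ℂ) (n : ℕ) : toL (f ^ n) = toL f ^ n := map_pow _ _ _

theorem toL_injective : Function.Injective toL := HahnSeries.ofPowerSeries_injective

theorem coeff_toL_natCast (f : PowerSeries ℂ) (i : ℕ) :
    (toL f).coeff (i : ℤ) = PowerSeries.coeff i f :=
  HahnSeries.ofPowerSeries_apply_coeff _ _

theorem coeff_toL_of_neg (f : PowerSeries ℂ) {i : ℤ} (h : i < 0) : (toL f).coeff i = 0 := by
  have := PowerSeries.coeff_coe f i
  rw [if_pos h] at this
  exact this

theorem coeff_single_mul_toL (m i : ℤ) (f : PowerSeries ℂ) :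
    (HahnSeries.single m (1 : ℂ) * toL f).coeff i = (toL f).coeff (i - m) := by
  have := HahnSeries.coeff_single_mul_add (r := (1 : ℂ)) (x := toL f) (a := i - m) (b := m)
  rwa [sub_add_cancel, one_mul] at this

theorem exists_eq_toL {F : LaurentSeries ℂ} (h : ∀ i < 0, F.coeff i = 0) :
    ∃ f : PowerSeries ℂ, F = toL f := by
  refine ⟨PowerSeries.mk fun i => F.coeff i, ?_⟩
  ext i
  rcases lt_or_ge i 0 with hi | hi
  · rw [h i hi, coeff_toL_of_neg _ hi]
  · lift i to ℕ using hi
    rw [coeff_toL_natCast, PowerSeries.coeff_mk]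

theorem single_natCast_eq_toL (k : ℕ) :
    HahnSeries.single (k : ℤ) (1 : ℂ) = toL (PowerSeries.X ^ k) :=
  (HahnSeries.ofPowerSeries_X_pow k).symm

theorem single_zpow_one (m : ℤ) :
    (HahnSeries.single (1 : ℤ) (1 : ℂ)) ^ m = HahnSeries.single m (1 : ℂ) :=
  (RatFunc.single_zpow m).symm

theorem toL_C (c : ℂ) : toL (PowerSeries.C c) = cst c := HahnSeries.ofPowerSeries_C c

theorem single_mul_single' (m k : ℤ) :
    HahnSeries.single m (1 : ℂ) * HahnSeries.single k (1 : ℂ) = HahnSeries.single (m + k) 1 := by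
  rw [HahnSeries.single_mul_single, one_mul]

/-- `compL` splits off exactly the order of the series; here any splitting `w^m G` is shown to give
the same value. This is what makes composition additive and multiplicative. -/
theorem compL_single_mul {f : PowerSeries ℂ} (hf : PowerSeries.constantCoeff f = 0) (hf0 : f ≠ 0)
    (m : ℤ) (G : PowerSeries ℂ) :
    compL (HahnSeries.single m (1 : ℂ) * toL G) f = toL f ^ m * toL (G.subst f) := by
  have hs : PowerSeries.HasSubst f := PowerSeries.HasSubst.of_constantCoeff_zero' hf
  have hL : toL f ≠ 0 := fun h => hf0 (toL_injective (h.trans (map_zero _).symm))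
  set F : LaurentSeries ℂ := HahnSeries.single m (1 : ℂ) * toL G with hF
  have e : HahnSeries.single F.order (1 : ℂ) * toL F.powerSeriesPart = F :=
    LaurentSeries.single_order_mul_powerSeriesPart F
  -- Two splittings differ by moving a power `X^k` into the regular factor, and substitution turns
  -- `X^k` into `f^k`.
  have aux : ∀ (k : ℕ) (m : ℤ) (A B : PowerSeries ℂ),
      HahnSeries.single (m + k) (1 : ℂ) * toL A = HahnSeries.single m (1 : ℂ) * toL B →
      toL f ^ (m + k) * toL (A.subst f) = toL f ^ m * toL (B.subst f) := by
    intro k m A B h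
    rw [← single_mul_single', mul_assoc, single_natCast_eq_toL, ← toL_mul] at h
    have h1 : toL (PowerSeries.X ^ k * A) = toL B :=
      mul_left_cancel₀ (by simp) h
    have h2 := toL_injective h1
    rw [← h2, PowerSeries.subst_mul hs, PowerSeries.subst_pow hs, PowerSeries.subst_X hs, toL_mul,
      toL_pow, zpow_add₀ hL, zpow_natCast, mul_assoc]
  unfold compL
  rcases le_total m F.order with h | h
  · obtain ⟨k, hk⟩ := Int.eq_ofNat_of_zero_le (sub_nonneg.2 h)
    have hk' : F.order = m + k := by omega
    rw [hk']
    apply aux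
    rw [← hk', e]
  · obtain ⟨k, hk⟩ := Int.eq_ofNat_of_zero_le (sub_nonneg.2 h)
    have hk' : m = F.order + k := by omega
    symm
    conv_lhs => rw [hk']
    apply aux
    rw [e, ← hk']

theorem exists_eq_single_mul (F : LaurentSeries ℂ) :
    ∃ (m : ℤ) (G : PowerSeries ℂ), F = HahnSeries.single m (1 : ℂ) * toL G :=
  ⟨F.order, F.powerSeriesPart, (LaurentSeries.single_order_mul_powerSeriesPart F).symm⟩

theorem exists_eq_single_mul_pair (F F' : LaurentSeries ℂ) :
    ∃ (m : ℤ) (G G' : PowerSeries ℂ), F = HahnSeries.single m (1 : ℂ) * toL G ∧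
      F' = HahnSeries.single m (1 : ℂ) * toL G' := by
  obtain ⟨m, G, hG⟩ := exists_eq_single_mul F
  obtain ⟨m', G', hG'⟩ := exists_eq_single_mul F'
  rcases le_total m m' with h | h
  · obtain ⟨k, hk⟩ := Int.eq_ofNat_of_zero_le (sub_nonneg.2 h)
    refine ⟨m, G, PowerSeries.X ^ k * G', hG, ?_⟩
    rw [hG', toL_mul, ← single_natCast_eq_toL, ← mul_assoc, single_mul_single',
      show m + k = m' by omega]
  · obtain ⟨k, hk⟩ := Int.eq_ofNat_of_zero_le (sub_nonneg.2 h)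
    refine ⟨m', PowerSeries.X ^ k * G, G', ?_, hG'⟩
    rw [hG, toL_mul, ← single_natCast_eq_toL, ← mul_assoc, single_mul_single',
      show m' + k = m by omega]

theorem compL_toL {f : PowerSeries ℂ} (hf : PowerSeries.constantCoeff f = 0) (hf0 : f ≠ 0)
    (G : PowerSeries ℂ) : compL (toL G) f = toL (G.subst f) := by
  have := compL_single_mul hf hf0 0 G
  simpa using this

/-- Composition with a nonzero power series without constant term, as a ring homomorphism. -/
def compHom (f : PowerSeries ℂ) (hf : PowerSeries.constantCoeff f = 0) (hf0 : f ≠ 0) :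
    LaurentSeries ℂ →+* LaurentSeries ℂ where
  toFun F := compL F f
  map_one' := by
    have := compL_toL hf hf0 (PowerSeries.C 1)
    rw [PowerSeries.subst_C] at this
    change _ = toL (PowerSeries.C 1) at this
    simpa using this
  map_zero' := by
    rw [← toL_zero, compL_toL hf hf0, ← map_zero (PowerSeries.C (R := ℂ)), PowerSeries.subst_C]
    rfl
  map_mul' F F' := by
    have hL : toL f ≠ 0 := fun h => hf0 (toL_injective (h.trans (map_zero _).symm))
    obtain ⟨m, G, rfl⟩ := exists_eq_single_mul F
    obtain ⟨m', G', rfl⟩ := exists_eq_single_mul F'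
    have e : HahnSeries.single m (1 : ℂ) * toL G * (HahnSeries.single m' (1 : ℂ) * toL G') =
        HahnSeries.single (m + m') (1 : ℂ) * toL (G * G') := by
      rw [← single_mul_single', toL_mul]; ring
    rw [e, compL_single_mul hf hf0, compL_single_mul hf hf0, compL_single_mul hf hf0,
      PowerSeries.subst_mul (PowerSeries.HasSubst.of_constantCoeff_zero' hf), toL_mul,
      zpow_add₀ hL]
    ring
  map_add' F F' := by
    obtain ⟨m, G, G', rfl, rfl⟩ := exists_eq_single_mul_pair F F'
    rw [← mul_add, ← toL_add, compL_single_mul hf hf0, compL_single_mul hf hf0,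
      compL_single_mul hf hf0,
      PowerSeries.subst_add (PowerSeries.HasSubst.of_constantCoeff_zero' hf), toL_add, mul_add]

theorem compHom_apply (f : PowerSeries ℂ) (hf : PowerSeries.constantCoeff f = 0) (hf0 : f ≠ 0)
    (F : LaurentSeries ℂ) : compHom f hf hf0 F = compL F f := rfl

theorem compL_cst {f : PowerSeries ℂ} (hf : PowerSeries.constantCoeff f = 0) (hf0 : f ≠ 0)
    (c : ℂ) : compL (cst c) f = cst c := by
  rw [← toL_C, compL_toL hf hf0, PowerSeries.subst_C]
  rfl

theorem compL_single {f : PowerSeries ℂ} (hf : PowerSeries.constantCoeff f = 0) (hf0 : f ≠ 0)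
    (m : ℤ) : compL (HahnSeries.single m (1 : ℂ)) f = toL f ^ m := by
  have := compL_single_mul hf hf0 m (PowerSeries.C 1)
  rw [PowerSeries.subst_C] at this
  change _ = _ * toL (PowerSeries.C 1) at this
  simpa using this

end
end TodaWhitham

namespace TodaWhitham
noncomputable section

/-! ### Functions on slices -/

/-- `g` is `C¹` on the finite-dimensional slices of `D`. -/
def SliceC1 {N : ℕ} (D : Set (Point N)) (g : Point N → ℂ) : Prop :=
  ∀ (x : Point N) (m : ℕ) (d : Fin m → Point N), charge x = 0 → (∀ l, charge (d l) = 0) →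
    ContDiffOn ℝ 1 (fun τ => g (slice x d τ)) {τ | slice x d τ ∈ D}

variable {N : ℕ}

theorem slice_zero {m : ℕ} (x : Point N) (d : Fin m → Point N) : slice x d 0 = x := by
  simp [slice]

theorem slice_one (x v : Point N) (τ : Fin 1 → ℝ) : slice x ![v] τ = x + τ 0 • v := by
  simp [slice]

theorem slice_two (x v w : Point N) (τ : Fin 2 → ℝ) :
    slice x ![v, w] τ = x + (τ 0 • v + τ 1 • w) := by
  simp [slice]

theorem charge_sDir_hop (a b : Idx N) : charge (sDir (hop a b)) = 0 := by
  simp [charge, sDir, hop, Finset.sum_sub_distrib, Pi.single_apply]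

theorem charge_tDir (j : ℕ+) (a : Idx N) (τ : ℂ) : charge (tDir j a τ) = 0 := by
  simp [charge, tDir]

theorem sDir_add (v w : Idx N → ℤ) : sDir (v + w) = sDir v + sDir w := by
  ext <;> simp [sDir]

theorem tDir_add (j : ℕ+) (a : Idx N) (τ τ' : ℂ) :
    tDir j a (τ + τ') = tDir j a τ + tDir j a τ' := by
  simp [tDir]

theorem tDir_smul (j : ℕ+) (a : Idx N) (c : ℝ) (τ : ℂ) :
    tDir j a (c * τ) = c • tDir j a τ := by
  simp [tDir]

theorem charge_vec_one {v : Point N} (hv : charge v = 0) : ∀ l, charge (![v] l) = 0 := by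
  intro l
  fin_cases l
  exact hv

theorem charge_vec_two {v w : Point N} (hv : charge v = 0) (hw : charge w = 0) :
    ∀ l, charge (![v, w] l) = 0 := by
  intro l
  fin_cases l
  · exact hv
  · exact hw

/-! ### Derivatives of slicewise `C¹` functions at a point -/

section

variable {D : Set (Point N)} (hD : IsDomainZeroCharge D) {x : Point N} (hx : x ∈ D)

include hD hx

theorem slice_mem_nhds {m : ℕ} {d : Fin m → Point N} (hd : ∀ l, charge (d l) = 0) :
    {τ | slice x d τ ∈ D} ∈ 𝓝 (0 : Fin m → ℝ) :=
  (hD.isOpen_slice x m d (hD.charge_eq x hx) hd).mem_nhds (by simpa [slice_zero] using hx)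

theorem eventually_line_mem {v : Point N} (hv : charge v = 0) :
    ∀ᶠ t : ℝ in 𝓝 0, x + t • v ∈ D := by
  have h := slice_mem_nhds hD hx (charge_vec_one hv)
  have hc : Tendsto (fun t : ℝ => (fun _ : Fin 1 => t)) (𝓝 0) (𝓝 0) :=
    Continuous.tendsto (by fun_prop) 0
  filter_upwards [hc h] with t ht
  simpa [slice_one] using ht

theorem SliceC1.differentiableAt {g : Point N → ℂ} (hg : SliceC1 D g) {m : ℕ}
    {d : Fin m → Point N} (hd : ∀ l, charge (d l) = 0) :
    DifferentiableAt ℝ (fun τ => g (slice x d τ)) 0 :=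
  ((hg x m d (hD.charge_eq x hx) hd).contDiffAt (slice_mem_nhds hD hx hd)).differentiableAt
    one_ne_zero

theorem SliceC1.hasLineDerivAt {g : Point N → ℂ} (hg : SliceC1 D g) {v : Point N}
    (hv : charge v = 0) : HasLineDerivAt ℝ g
      (fderiv ℝ (fun τ => g (slice x ![v] τ)) 0 (fun _ => 1)) x v := by
  have h := (hg.differentiableAt hD hx (charge_vec_one hv)).hasFDerivAt
  have hl : HasDerivAt (fun t : ℝ => (fun _ : Fin 1 => t)) (fun _ => 1) 0 :=
    hasDerivAt_pi.2 fun _ => hasDerivAt_id _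
  have := h.comp_hasDerivAt_of_eq (0 : ℝ) hl (by rfl)
  simpa [HasLineDerivAt, Function.comp_def, slice_one] using this

theorem SliceC1.hasLineDerivAt_lineDeriv {g : Point N → ℂ} (hg : SliceC1 D g) {v : Point N}
    (hv : charge v = 0) : HasLineDerivAt ℝ g (lineDeriv ℝ g x v) x v :=
  (hg.hasLineDerivAt hD hx hv).lineDifferentiableAt.hasLineDerivAt

theorem SliceC1.hasLineDerivAt_two {g : Point N → ℂ} (hg : SliceC1 D g) {v w : Point N}
    (hv : charge v = 0) (hw : charge w = 0) (α β : ℝ) : HasLineDerivAt ℝ g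
      (fderiv ℝ (fun τ => g (slice x ![v, w] τ)) 0 ![α, β]) x (α • v + β • w) := by
  have h := (hg.differentiableAt hD hx (charge_vec_two hv hw)).hasFDerivAt
  have hl : HasDerivAt (fun t : ℝ => t • ![α, β]) ![α, β] 0 := by
    simpa using (hasDerivAt_id (0 : ℝ)).smul_const ![α, β]
  have := h.comp_hasDerivAt_of_eq (0 : ℝ) hl (by simp)
  simpa [HasLineDerivAt, Function.comp_def, slice_two, smul_add, mul_smul] using this

theorem SliceC1.lineDeriv_two {g : Point N → ℂ} (hg : SliceC1 D g) {v w : Point N}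
    (hv : charge v = 0) (hw : charge w = 0) (α β : ℝ) :
    lineDeriv ℝ g x (α • v + β • w) = α * lineDeriv ℝ g x v + β * lineDeriv ℝ g x w := by
  have h := fun α β => (hg.hasLineDerivAt_two hD hx hv hw α β).lineDeriv
  have h1 := h 1 0
  have h2 := h 0 1
  simp only [one_smul, zero_smul, add_zero, zero_add] at h1 h2
  rw [h, h1, h2]
  have e : (![α, β] : Fin 2 → ℝ) = α • ![1, 0] + β • ![0, 1] := by
    ext i
    fin_cases i <;> simp
  rw [e, map_add, map_smul, map_smul]
  simp

theorem SliceC1.lineDeriv_add {g : Point N → ℂ} (hg : SliceC1 D g) {v w : Point N}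
    (hv : charge v = 0) (hw : charge w = 0) :
    lineDeriv ℝ g x (v + w) = lineDeriv ℝ g x v + lineDeriv ℝ g x w := by
  simpa using hg.lineDeriv_two hD hx hv hw 1 1

/-- The complex time direction is a real two-dimensional slice spanned by `1` and `Complex.I`. The
real derivative there exists by `C¹` regularity, and complex linearity of the directional
derivatives makes it a complex derivative. -/
theorem SliceC1.hasDerivAt_time {g : Point N → ℂ} (hg : SliceC1 D g) {j : ℕ+} {a : Idx N} {c : ℂ}
    (h : ∀ τ : ℂ, lineDeriv ℝ g x (tDir j a τ) = τ * c) :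
    HasDerivAt (fun τ : ℂ => g (x + tDir j a τ)) c 0 := by
  have hf := (hg.differentiableAt hD hx
    (charge_vec_two (charge_tDir j a 1) (charge_tDir j a Complex.I))).hasFDerivAt
  set L := fderiv ℝ (fun τ => g (slice x ![tDir j a 1, tDir j a Complex.I] τ)) 0 with hL
  let A : ℂ →L[ℝ] (Fin 2 → ℝ) := ContinuousLinearMap.pi ![Complex.reCLM, Complex.imCLM]
  have e : ∀ τ : ℂ, slice x ![tDir j a 1, tDir j a Complex.I] (A τ) = x + tDir j a τ := by
    intro τ
    rw [slice_two]
    have h0 : A τ 0 = τ.re := rfl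
    have h1 : A τ 1 = τ.im := rfl
    rw [h0, h1, ← tDir_smul, ← tDir_smul, ← tDir_add, mul_one, Complex.re_add_im]
  have hc : HasFDerivAt (fun τ : ℂ => g (x + tDir j a τ)) (L.comp A) 0 := by
    have h1 : HasFDerivAt (fun τ => g (slice x ![tDir j a 1, tDir j a Complex.I] τ)) L (A 0) := by
      rw [map_zero]; exact hf
    have := h1.comp (0 : ℂ) A.hasFDerivAt
    simpa only [Function.comp_def, e] using this
  have hval : ∀ τ : ℂ, L (A τ) = τ * c := by
    intro τ
    rw [← h τ]
    have h2 := (hg.hasLineDerivAt_two hD hx (charge_tDir j a 1) (charge_tDir j a Complex.I)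
      τ.re τ.im).lineDeriv
    rw [← tDir_smul, ← tDir_smul, ← tDir_add, mul_one, Complex.re_add_im] at h2
    rw [h2, hL]
    congr 1
    ext i
    fin_cases i <;> rfl
  have hR : (ContinuousLinearMap.toSpanSingleton ℂ c).restrictScalars ℝ = L.comp A := by
    ext τ; simp [hval]
  have hfin : HasFDerivAt (𝕜 := ℂ) (fun τ : ℂ => g (x + tDir j a τ))
      (ContinuousLinearMap.toSpanSingleton ℂ c) 0 := hasFDerivAt_of_restrictScalars ℝ hc hR
  exact hasFDerivAt_iff_hasDerivAt.1 hfin |>.congr_deriv (by simp)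

end

/-! ### Limits of derivatives and of difference quotients -/

section

variable {D : Set (Point N)} (hD : IsDomainZeroCharge D) {x : Point N} (hx : x ∈ D)
  {E : Set ℝ} (hE : ∀ ε ∈ E, 0 < ε) {g : ℝ → Point N → ℂ} {g₀ : Point N → ℂ}
  (hg : ∀ ε ∈ E, SliceC1 D (g ε)) (hg₀ : SliceC1 D g₀)
  (hlim : ∀ (x : Point N) (m : ℕ) (d : Fin m → Point N), charge x = 0 → (∀ l, charge (d l) = 0) →
    TendstoLocallyUniformlyOn (fun ε τ => fderiv ℝ (fun τ' => g ε (slice x d τ')) τ)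
      (fun τ => fderiv ℝ (fun τ' => g₀ (slice x d τ')) τ) (𝓝[E] 0) {τ | slice x d τ ∈ D})

include hD hx hg hg₀ hlim

theorem tendsto_lineDeriv {v : Point N} (hv : charge v = 0) :
    Tendsto (fun ε => lineDeriv ℝ (g ε) x v) (𝓝[E] 0) (𝓝 (lineDeriv ℝ g₀ x v)) := by
  have h := (hlim x 1 ![v] (hD.charge_eq x hx) (charge_vec_one hv)).tendsto_at
    (show (0 : Fin 1 → ℝ) ∈ {τ | slice x ![v] τ ∈ D} by simpa [slice_zero] using hx)
  have h2 := ((ContinuousLinearMap.apply ℝ ℂ (fun _ : Fin 1 => (1 : ℝ))).continuous.tendsto _).comp h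
  rw [(hg₀.hasLineDerivAt hD hx hv).lineDeriv]
  refine h2.congr' ?_
  filter_upwards [self_mem_nhdsWithin] with ε hε
  rw [((hg ε hε).hasLineDerivAt hD hx hv).lineDeriv]
  rfl

include hE

/-- The step length shrinks together with the index `ε` of the function, so pointwise convergence of
derivatives would not suffice. Locally uniform convergence and the mean value inequality control the
whole segment. -/
theorem tendsto_difference_quotient {v : Point N} (hv : charge v = 0) (k : ℕ) :
    Tendsto (fun ε : ℝ => (g ε (x + ((k : ℝ) * ε) • v) - g ε x) / (ε : ℂ)) (𝓝[E] 0)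
      (𝓝 (k * lineDeriv ℝ g₀ x v)) := by
  have hd := charge_vec_one hv
  have hcx := hD.charge_eq x hx
  set U : Set (Fin 1 → ℝ) := {τ | slice x ![v] τ ∈ D} with hU
  have hUo : IsOpen U := hD.isOpen_slice x 1 ![v] hcx hd
  have h0U : (0 : Fin 1 → ℝ) ∈ U := by simpa [hU, slice_zero] using hx
  set L := fderiv ℝ (fun τ' => g₀ (slice x ![v] τ')) 0 with hL
  rw [(hg₀.hasLineDerivAt hD hx hv).lineDeriv, ← hL, Metric.tendsto_nhds]
  intro δ hδ
  -- Two errors of size `δ'` over a step of length `k ε` must stay below `δ ε`; the `k + 1` also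
  -- covers `k = 0`.
  set δ' := δ / (4 * (k + 1)) with hδ'
  have hk : (0 : ℝ) < k + 1 := by positivity
  have hδ'0 : 0 < δ' := by positivity
  obtain ⟨t, ht, htl⟩ := Metric.tendstoLocallyUniformlyOn_iff.1 (hlim x 1 ![v] hcx hd) δ' hδ'0 0 h0U
  rw [hUo.nhdsWithin_eq h0U] at ht
  have hcont : ContinuousAt (fderiv ℝ (fun τ' => g₀ (slice x ![v] τ'))) 0 :=
    ((hg₀ x 1 ![v] hcx hd).continuousOn_fderiv_of_isOpen hUo le_rfl).continuousAt
      (hUo.mem_nhds h0U)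
  have hcont' := Metric.tendsto_nhds.1 hcont δ' hδ'0
  obtain ⟨r, hr, hball⟩ := Metric.mem_nhds_iff.1
    (Filter.inter_mem (Filter.inter_mem ht (hUo.mem_nhds h0U)) hcont')
  have hsmall : ∀ᶠ ε : ℝ in 𝓝[E] 0, |(k : ℝ) * ε| < r := by
    have : Tendsto (fun ε : ℝ => |(k : ℝ) * ε|) (𝓝[E] 0) (𝓝 0) := by
      have h : Continuous (fun ε : ℝ => |(k : ℝ) * ε|) := by fun_prop
      have := (h.tendsto 0).mono_left (nhdsWithin_le_nhds (s := E))
      simpa using this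
    exact this.eventually_lt_const hr
  filter_upwards [htl, hsmall, self_mem_nhdsWithin] with ε h1 h2 hε
  have hεpos := hE ε hε
  -- On the ball the derivative of `g ε` is within `2δ'` of `L`: one `δ'` from uniform convergence,
  -- one from continuity of the limiting derivative.
  have hb := Convex.norm_image_sub_le_of_norm_fderiv_le' (𝕜 := ℝ) (s := Metric.ball 0 r)
    (f := fun τ' => g ε (slice x ![v] τ')) (φ := L) (C := 2 * δ')
    (x := 0) (y := fun _ => (k : ℝ) * ε)
    (fun τ hτ => (((hg ε hε) x 1 ![v] hcx hd).contDiffAt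
      (hUo.mem_nhds (hball hτ).1.2)).differentiableAt one_ne_zero)
    (fun τ hτ => by
      have e1 := h1 τ (hball hτ).1.1
      have e2 : dist (fderiv ℝ (fun τ' => g₀ (slice x ![v] τ')) τ) L < δ' := (hball hτ).2
      rw [dist_comm, dist_eq_norm] at e1
      rw [dist_eq_norm] at e2
      calc _ = ‖(fderiv ℝ (fun τ' => g ε (slice x ![v] τ')) τ -
            fderiv ℝ (fun τ' => g₀ (slice x ![v] τ')) τ) +
            (fderiv ℝ (fun τ' => g₀ (slice x ![v] τ')) τ - L)‖ := by congr 1; abel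
        _ ≤ _ := (norm_add_le _ _).trans (by linarith))
    (convex_ball 0 r) (Metric.mem_ball_self hr)
    (by
      rw [mem_ball_zero_iff, pi_norm_lt_iff hr]
      intro _
      exact h2)
  have hn : ‖(fun _ : Fin 1 => (k : ℝ) * ε)‖ = k * ε := by
    rw [pi_norm_const, Real.norm_eq_abs, abs_of_nonneg (by positivity)]
  have hLy : L (fun _ : Fin 1 => (k : ℝ) * ε) = (k : ℂ) * ε * L (fun _ => 1) := by
    have : (fun _ : Fin 1 => (k : ℝ) * ε) = ((k : ℝ) * ε) • (fun _ : Fin 1 => (1 : ℝ)) := by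
      ext; simp
    rw [this, map_smul, Complex.real_smul]
    push_cast
    ring
  simp only [slice_one, sub_zero, Pi.zero_apply, zero_smul, add_zero] at hb
  rw [hn, hLy] at hb
  have hεC : (ε : ℂ) ≠ 0 := by exact_mod_cast hεpos.ne'
  rw [dist_eq_norm]
  have e : (g ε (x + ((k : ℝ) * ε) • v) - g ε x) / (ε : ℂ) - k * L (fun _ => 1) =
      (g ε (x + ((k : ℝ) * ε) • v) - g ε x - (k : ℂ) * ε * L (fun _ => 1)) / ε := by
    field_simp
  rw [e, norm_div, Complex.norm_real, Real.norm_eq_abs, abs_of_pos hεpos, div_lt_iff₀ hεpos]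
  refine hb.trans_lt ?_
  have : 2 * δ' * k < δ := by
    rw [hδ']
    have : 2 * (δ / (4 * (↑k + 1))) * k = δ * (k / (2 * (k + 1))) := by field_simp; ring
    rw [this]
    have : (k : ℝ) / (2 * (k + 1)) < 1 := by
      rw [div_lt_one (by positivity)]; linarith [(Nat.cast_nonneg k : (0 : ℝ) ≤ k)]
    nlinarith
  nlinarith

end
end
end TodaWhitham

namespace TodaWhitham
noncomputable section

variable {N : ℕ}

/-! ### Left multiples of a pair of operators, and their first rows -/

/-- `A ↦ A · Y` as a linear map. -/
def mulLin (Y : Op N) : BandOp N →ₗ[ℂ] Op N where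
  toFun A := A.mul Y
  map_add' A B := by
    funext m n
    simp only [BandOp.mul, Pi.add_apply]
    exact Finsupp.sum_add_index' (by simp) (by intro i c d; simp [add_mul])
  map_smul' z A := by
    funext m n
    simp only [BandOp.mul, Pi.smul_apply, RingHom.id_apply]
    rw [Finsupp.sum_smul_index' (by simp), Finsupp.smul_sum]
    simp

theorem mulLin_apply (Y : Op N) (A : BandOp N) : mulLin Y A = A.mul Y := rfl

theorem mulLin_single (Y : Op N) (i : ℤ) (c : ℤ → Matrix (Fin N) (Fin N) ℂ) (m n : ℤ) :
    mulLin Y (Finsupp.single i c) m n = c n * Y (m - i) (n + i) := by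
  rw [mulLin_apply, BandOp.mul, Finsupp.sum_single_index (by simp)]

/-- The product of two finite sums. -/
def BandOp.comp (A B : BandOp N) : BandOp N :=
  ∑ i ∈ A.support, ∑ l ∈ B.support, Finsupp.single (i + l) fun n => A i n * B l (n + i)

theorem BandOp.comp_mul (A B : BandOp N) (Y : Op N) : (A.comp B).mul Y = A.mul (B.mul Y) := by
  funext m n
  rw [← mulLin_apply, BandOp.comp, map_sum]
  simp only [map_sum, Finset.sum_apply, mulLin_single, BandOp.mul, Finsupp.sum, Finset.mul_sum]
  refine Finset.sum_congr rfl fun i _ => Finset.sum_congr rfl fun l _ => ?_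
  rw [mul_assoc, sub_sub, add_assoc]

theorem BandOp.mul_mulDiagShift (A : BandOp N) (Y : Op N) (d : Fin N → ℤ) :
    A.mul (mulDiagShift Y d) = mulDiagShift (A.mul Y) d := by
  funext m n
  ext r k
  simp only [BandOp.mul, mulDiagShift, Finsupp.sum, Matrix.sum_apply, Matrix.of_apply,
    Matrix.mul_apply]
  refine Finset.sum_congr rfl fun i _ => Finset.sum_congr rfl fun l _ => ?_
  rw [sub_right_comm]

theorem BandOp.mul_apply_row (A : BandOp N) (Y : Op N) (m n : ℤ) (r k : Fin N) :
    A.mul Y m n r k = ∑ i ∈ A.support, ∑ l, A i n r l * Y (m - i) (n + i) l k := by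
  simp only [BandOp.mul, Finsupp.sum, Matrix.sum_apply, Matrix.mul_apply]

variable [NeZero N]

/-- The first rows at `n` of a pair of operators: the coefficients with respect to the local
coordinates `w = Λ⁻¹` and `w = Λ`. -/
def rowFun (Y Yb : Op N) (n : ℤ) : Idx N → ℤ → ℂ
  | Sum.inl k, m => Y (-m) n 0 k
  | Sum.inr k, m => Yb m n 0 k

/-- The first rows at `n` of `A · S` and `A · S̄`. -/
def rowMap (S Sb : Op N) (n : ℤ) : BandOp N →ₗ[ℂ] (Idx N → ℤ → ℂ) where
  toFun A := rowFun (mulLin S A) (mulLin Sb A) n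
  map_add' A B := by
    funext b m
    cases b <;> simp [rowFun]
  map_smul' c A := by
    funext b m
    cases b <;> simp [rowFun]

theorem rowMap_apply (S Sb : Op N) (n : ℤ) (A : BandOp N) :
    rowMap S Sb n A = rowFun (A.mul S) (A.mul Sb) n := rfl

/-- The highest nonnegative power of `Λ` in the first row of `A` survives unchanged in `A·S`, since
`S` has leading term `1` and only lower powers otherwise. -/
theorem row_eq_zero_of_nonneg {S : Op N} (hS : IsGMinus S) {n : ℤ} {A : BandOp N}
    (h : ∀ i k, 0 ≤ i → A.mul S i n 0 k = 0) (i : ℤ) (hi : 0 ≤ i) (k : Fin N) :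
    A i n 0 k = 0 := by
  classical
  by_contra hne
  let s := A.support.filter fun i => 0 ≤ i ∧ ∃ k, A i n 0 k ≠ 0
  have hmem : ∀ i k, 0 ≤ i → A i n 0 k ≠ 0 → i ∈ s := by
    intro i k hi hk
    refine Finset.mem_filter.2 ⟨Finsupp.mem_support_iff.2 ?_, hi, k, hk⟩
    intro h0
    rw [h0] at hk
    exact hk rfl
  obtain ⟨i, hi, hmax⟩ := s.exists_max_image id ⟨i, hmem i k hi hne⟩
  obtain ⟨hsup, hi0, k, hk⟩ := Finset.mem_filter.1 hi
  apply hk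
  have h1 := h i k hi0
  rw [BandOp.mul_apply_row, Finset.sum_eq_single i] at h1
  · simpa [hS.1, Matrix.one_apply] using h1
  · intro i' _ hne
    refine Finset.sum_eq_zero fun l _ => ?_
    rcases lt_or_gt_of_ne hne with hlt | hlt
    · rw [hS.2 _ _ (by omega)]
      simp
    · have : A i' n 0 l = 0 := by
        by_contra h0
        have := hmax i' (hmem i' l (by omega) h0)
        simp only [id] at this
        omega
      rw [this, zero_mul]
  · intro h0
    exact absurd hsup h0

/-- Mirror image: the lowest negative power in the first row of `A` meets only the leading term of
`S̄`. -/
theorem row_eq_zero_of_neg {Sb : Op N} (hS : IsGPlus Sb) {n : ℤ} {A : BandOp N}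
    (h : ∀ i k, i < 0 → A.mul Sb i n 0 k = 0) (i : ℤ) (hi : i < 0) (k : Fin N) :
    A i n 0 k = 0 := by
  classical
  by_contra hne
  let s := A.support.filter fun i => i < 0 ∧ ∃ k, A i n 0 k ≠ 0
  have hmem : ∀ i k, i < 0 → A i n 0 k ≠ 0 → i ∈ s := by
    intro i k hi hk
    refine Finset.mem_filter.2 ⟨Finsupp.mem_support_iff.2 ?_, hi, k, hk⟩
    intro h0
    rw [h0] at hk
    exact hk rfl
  obtain ⟨i, hi, hmin⟩ := s.exists_min_image id ⟨i, hmem i k hi hne⟩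
  obtain ⟨hsup, hi0, k, hk⟩ := Finset.mem_filter.1 hi
  apply hk
  -- The leading term is not the identity here, so the whole row vector has to be cancelled using
  -- invertibility of `Sb 0 (n + i)`.
  have h1 : Matrix.vecMul (A i n 0) (Sb 0 (n + i)) = Matrix.vecMul 0 (Sb 0 (n + i)) := by
    ext k
    have h1 := h i k hi0
    rw [BandOp.mul_apply_row, Finset.sum_eq_single i] at h1
    · simpa [Matrix.vecMul, dotProduct] using h1
    · intro i' _ hne
      refine Finset.sum_eq_zero fun l _ => ?_
      rcases lt_or_gt_of_ne hne with hlt | hlt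
      · have : A i' n 0 l = 0 := by
          by_contra h0
          have := hmin i' (hmem i' l (by omega) h0)
          simp only [id] at this
          omega
        rw [this, zero_mul]
      · rw [hS.2 _ _ (by omega)]
        simp
    · intro h0
      exact absurd hsup h0
  have := Matrix.vecMul_injective_of_isUnit (hS.1 (n + i)) h1
  rw [this]
  rfl

/-- The unbarred half kills the nonnegative part of the first row of `A` and the barred half its
negative part. Only that row enters, so the element itself vanishes. This uniqueness is the rigidity
behind every identity between time derivatives and shifts. -/
theorem eq_zero_of_mem_range_rowMap {S Sb : Op N} (hS : IsGMinus S) (hSb : IsGPlus Sb) {n : ℤ}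
    {u : Idx N → ℤ → ℂ} (hu : u ∈ LinearMap.range (rowMap S Sb n))
    (h1 : ∀ k m, m ≤ 0 → u (Sum.inl k) m = 0) (h2 : ∀ k m, m < 0 → u (Sum.inr k) m = 0) :
    u = 0 := by
  obtain ⟨A, rfl⟩ := hu
  have hp := row_eq_zero_of_nonneg (A := A) (n := n) hS fun i k hi => by
    have := h1 k (-i) (by omega)
    simpa [rowMap_apply, rowFun] using this
  have hm := row_eq_zero_of_neg (A := A) (n := n) hSb fun i k hi => h2 k i hi
  have hA : ∀ i k, A i n 0 k = 0 := fun i k =>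
    (le_or_gt 0 i).elim (fun h => hp i h k) fun h => hm i h k
  funext b m
  cases b <;> simp [rowMap_apply, rowFun, BandOp.mul_apply_row, hA]

theorem one_row_mem (S Sb : Op N) (n : ℤ) :
    rowFun S Sb n ∈ LinearMap.range (rowMap S Sb n) := by
  refine ⟨Finsupp.single 0 fun _ => 1, ?_⟩
  funext b m
  cases b <;> simp [rowMap, rowFun, mulLin_single]

/-- If the shifted solution is `X` times the original one, its left multiples are left multiples of
the original by `A·X`. The change of `W_0` and `W̄_0` appears as the translation by `v b`; with `w =
Λ⁻¹` and `w = Λ` the sign is the same in both halves. -/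
theorem shift_row_mem {S Sb S' Sb' : Op N} {v : Idx N → ℤ} {X : BandOp N}
    (h1 : mulDiagShift S' (fun k => v (Sum.inl k)) = X.mul S)
    (h2 : mulDiagShift Sb' (fun k => -v (Sum.inr k)) = X.mul Sb) {n : ℤ} {u : Idx N → ℤ → ℂ}
    (hu : u ∈ LinearMap.range (rowMap S' Sb' n)) :
    (fun b m => u b (m + v b)) ∈ LinearMap.range (rowMap S Sb n) := by
  obtain ⟨A, rfl⟩ := hu
  refine ⟨A.comp X, ?_⟩
  funext b m
  rw [rowMap_apply, rowMap_apply, BandOp.comp_mul, BandOp.comp_mul, ← h1, ← h2,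
    BandOp.mul_mulDiagShift, BandOp.mul_mulDiagShift]
  cases b with
  | inl k =>
    simp only [rowFun, mulDiagShift, Matrix.of_apply]
    congr 1
    ring_nf
  | inr k =>
    simp only [rowFun, mulDiagShift, Matrix.of_apply]
    congr 1
    ring_nf

variable {ε : ℝ} {D : Set (Point N)} {S Sb : Point N → Op N}

theorem IsTodaSolution.shift_mem (h : IsTodaSolution ε D S Sb) (a b : Idx N) (n : ℤ) {x : Point N}
    (k : ℕ) (hk : ∀ i ≤ k, x + ((i : ℝ) * ε) • sDir (hop a b) ∈ D) {u : Idx N → ℤ → ℂ}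
    (hu : u ∈ LinearMap.range (rowMap (S (x + ((k : ℝ) * ε) • sDir (hop a b)))
      (Sb (x + ((k : ℝ) * ε) • sDir (hop a b))) n)) :
    (fun c m => u c (m + k * hop a b c)) ∈ LinearMap.range (rowMap (S x) (Sb x) n) := by
  induction k generalizing u with
  | zero => simpa using hu
  | succ k ih =>
    have e : x + (((k + 1 : ℕ) : ℝ) * ε) • sDir (hop a b) =
        x + ((k : ℝ) * ε) • sDir (hop a b) + ε • sDir (hop a b) := by
      push_cast
      rw [add_mul, one_mul, add_assoc]
      congr 1
      exact add_smul ((k : ℝ) * ε) ε (sDir (hop a b) : Point N)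
    have hm := hk (k + 1) le_rfl
    rw [e] at hu hm
    obtain ⟨X, h1, h2⟩ := h.shift _ (hk k (by omega)) a b hm
    have := ih (fun i hi => hk i (by omega)) (shift_row_mem h1 h2 hu)
    convert this using 4
    push_cast
    ring

/-- The flow operator `B` applied to `(S, S̄)` is `ε` times the slow derivative plus the dressing
term. The latter multiplies the component `b = a` by `w^{-j}`, which is the index shift `m + j`. -/
theorem IsTodaSolution.flow_mem (h : IsTodaSolution ε D S Sb) (hε : ε ≠ 0) {x : Point N}
    (hx : x ∈ D) (j : ℕ+) (a : Idx N) (n : ℤ) : ∃ dψ : Idx N → ℤ → ℂ,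
      (∀ b m, HasDerivAt (fun τ : ℂ => rowFun (S (x + tDir j a τ)) (Sb (x + tDir j a τ)) n b m)
        (dψ b m) 0) ∧
      (fun b m => (ε : ℂ) * dψ b m +
        if b = a then rowFun (S x) (Sb x) n b (m + (j : ℤ)) else 0) ∈
          LinearMap.range (rowMap (S x) (Sb x) n) := by
  obtain ⟨B, hB⟩ := h.flow x hx j a
  have hεC : (ε : ℂ) ≠ 0 := by exact_mod_cast hε
  refine ⟨fun b m => (ε : ℂ)⁻¹ * (rowFun (B.mul (S x)) (B.mul (Sb x)) n b m -
    rowFun (dressW (S x) j a) (dressWBar (Sb x) j a) n b m), ?_, B, ?_⟩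
  · intro b m
    cases b with
    | inl k => exact (hB (-m) n 0 k).1
    | inr k => exact (hB m n 0 k).2
  · funext b m
    rw [rowMap_apply]
    have : rowFun (dressW (S x) j a) (dressWBar (Sb x) j a) n b m =
        if b = a then rowFun (S x) (Sb x) n b (m + (j : ℤ)) else 0 := by
      cases b with
      | inl k =>
        cases a with
        | inl l =>
          by_cases hkl : k = l
          · subst hkl
            simp [rowFun, dressW, mulUnitShift, sub_eq_add_neg, add_comm]
          · simp [rowFun, dressW, mulUnitShift, hkl]
        | inr l => simp [rowFun, dressW]
      | inr k =>
        cases a with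
        | inl l => simp [rowFun, dressWBar]
        | inr l =>
          by_cases hkl : k = l
          · subst hkl
            simp [rowFun, dressWBar, mulUnitShift]
          · simp [rowFun, dressWBar, mulUnitShift, hkl]
    simp only [this]
    field_simp
    ring

/-! ### The rows as Laurent series -/

/-- The order in `w` of the amplitude factor of the first row: `1` for `a = k ≠ 1`. -/
def ampOrder : Idx N → ℕ
  | Sum.inl k => if k = 0 then 0 else 1
  | Sum.inr _ => 0

/-- For `b = k ≠ 1` the series starts one order later because the off-diagonal entries of the
leading term `1` of `S` vanish. -/
theorem rowFun_eq_coeff {S Sb : Op N} (hS : IsGMinus S) (hSb : IsGPlus Sb) (n : ℤ) (b : Idx N)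
    (m : ℤ) : rowFun S Sb n b m =
      (HahnSeries.single (ampOrder b : ℤ) (1 : ℂ) * toL (amplitude S Sb n b)).coeff m := by
  rw [coeff_single_mul_toL]
  cases b with
  | inl k =>
    by_cases hk : k = 0
    · subst hk
      simp only [ampOrder, if_true, Nat.cast_zero, sub_zero]
      rcases lt_or_ge m 0 with hm | hm
      · rw [coeff_toL_of_neg _ hm]
        simp [rowFun, hS.2 (-m) n (by omega)]
      · lift m to ℕ using hm
        rw [coeff_toL_natCast]
        simp [rowFun, amplitude]
    · simp only [ampOrder, if_neg hk, Nat.cast_one]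
      rcases lt_or_ge m 1 with hm | hm
      · rw [coeff_toL_of_neg _ (by omega)]
        rcases eq_or_lt_of_le (show m ≤ 0 by omega) with h0 | h0
        · subst h0
          simp [rowFun, hS.1, Ne.symm hk]
        · simp [rowFun, hS.2 (-m) n (by omega)]
      · obtain ⟨l, hl⟩ := Int.eq_ofNat_of_zero_le (show 0 ≤ m - 1 by omega)
        obtain rfl : m = l + 1 := by omega
        rw [add_sub_cancel_right, coeff_toL_natCast]
        simp [rowFun, amplitude, hk]
  | inr k =>
    simp only [ampOrder, Nat.cast_zero, sub_zero]
    rcases lt_or_ge m 0 with hm | hm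
    · rw [coeff_toL_of_neg _ hm]
      simp [rowFun, hSb.2 m n hm]
    · lift m to ℕ using hm
      rw [coeff_toL_natCast]
      simp [rowFun, amplitude]

/-- Multiplication by the series `Φ b`, as a linear map to families of coefficients. -/
def normMap (Φ : Idx N → LaurentSeries ℂ) : (Idx N → LaurentSeries ℂ) →ₗ[ℂ] (Idx N → ℤ → ℂ) where
  toFun u b m := (Φ b * u b).coeff m
  map_add' u u' := by
    funext b m
    simp [mul_add]
  map_smul' c u := by
    funext b m
    change (Φ b * c • u b).coeff m = c * (Φ b * u b).coeff m
    have h : ∀ y : LaurentSeries ℂ, c • y = cst c * y := fun y => HahnSeries.C_mul_eq_smul.symm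
    rw [h, mul_left_comm, ← h]
    rfl

/-- After division by the wave functions the uniqueness hypotheses become: no poles anywhere, and no
constant term at the index `1`. At `k ≠ 1` the extra factor `w` already supplies the vanishing at
order `0`, and the barred half requires none. -/
theorem eq_zero_of_normMap_mem {S Sb : Op N} (hS : IsGMinus S) (hSb : IsGPlus Sb) {n : ℤ}
    {A : Idx N → PowerSeries ℂ} (hA : ∀ b, A b ≠ 0) {u : Idx N → LaurentSeries ℂ}
    (hu : normMap (fun b => HahnSeries.single (ampOrder b : ℤ) (1 : ℂ) * toL (A b)) u ∈
      LinearMap.range (rowMap S Sb n))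
    (hneg : ∀ b, ∀ m < 0, (u b).coeff m = 0) (h1 : (u (one N)).coeff 0 = 0) : u = 0 := by
  have hu' : ∀ b, ∃ f : PowerSeries ℂ, u b = toL f := fun b => exists_eq_toL (hneg b)
  choose f hf using hu'
  have hform : ∀ b m, normMap (fun b => HahnSeries.single (ampOrder b : ℤ) (1 : ℂ) * toL (A b)) u
      b m = (toL (A b * f b)).coeff (m - ampOrder b) := by
    intro b m
    change (_ * _ * u b).coeff m = _
    rw [hf, mul_assoc, ← toL_mul, coeff_single_mul_toL]
  have h0 := eq_zero_of_mem_range_rowMap hS hSb hu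
    (by
      intro k m hm
      rw [hform]
      by_cases hk : k = 0
      · subst hk
        simp only [ampOrder, if_true, Nat.cast_zero, sub_zero]
        rcases eq_or_lt_of_le hm with rfl | h
        · have e : PowerSeries.constantCoeff (f (Sum.inl 0)) = 0 := by
            have h2 := hf (one N)
            rw [h2] at h1
            have h3 := coeff_toL_natCast (f (one N)) 0
            rw [Nat.cast_zero, h1, PowerSeries.coeff_zero_eq_constantCoeff] at h3
            exact h3.symm
          have h3 := coeff_toL_natCast (A (Sum.inl 0) * f (Sum.inl 0)) 0
          rw [Nat.cast_zero] at h3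
          rw [h3, PowerSeries.coeff_zero_eq_constantCoeff, map_mul, e, mul_zero]
        · exact coeff_toL_of_neg _ h
      · simp only [ampOrder, if_neg hk, Nat.cast_one]
        exact coeff_toL_of_neg _ (by omega))
    (by
      intro k m hm
      rw [hform]
      simp only [ampOrder, Nat.cast_zero, sub_zero]
      exact coeff_toL_of_neg _ hm)
  funext b
  have hb : HahnSeries.single (ampOrder b : ℤ) (1 : ℂ) * toL (A b) * u b = 0 := by
    ext m
    exact congrFun (congrFun h0 b) m
  have hA' : toL (A b) ≠ 0 := fun h => hA b (toL_injective (h.trans toL_zero.symm))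
  rcases mul_eq_zero.1 hb with h | h
  · rcases mul_eq_zero.1 h with h | h
    · simp at h
    · exact absurd h hA'
  · exact h

end
end TodaWhitham

namespace TodaWhitham
noncomputable section

/-! ### Coefficientwise limits and derivatives of Laurent series -/

theorem coeff_single_mul (m i : ℤ) (F : LaurentSeries ℂ) :
    (HahnSeries.single m (1 : ℂ) * F).coeff i = F.coeff (i - m) := by
  have := HahnSeries.coeff_single_mul_add (r := (1 : ℂ)) (x := F) (a := i - m) (b := m)
  rwa [sub_add_cancel, one_mul] at this

theorem coeff_cst_mul (c : ℂ) (F : LaurentSeries ℂ) (i : ℤ) :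
    (cst c * F).coeff i = c * F.coeff i := by
  rw [HahnSeries.C_mul_eq_smul]
  rfl

theorem coeff_cst_zero (c : ℂ) : (cst c).coeff 0 = c := by
  simp

theorem tendsto_coeff_toL {ι : Type*} {l : Filter ι} {F : ι → PowerSeries ℂ} {G : PowerSeries ℂ}
    (h : ∀ i, Tendsto (fun t => PowerSeries.coeff i (F t)) l (𝓝 (PowerSeries.coeff i G))) (m : ℤ) :
    Tendsto (fun t => (toL (F t)).coeff m) l (𝓝 ((toL G).coeff m)) := by
  rcases lt_or_ge m 0 with hm | hm
  · simp only [coeff_toL_of_neg _ hm]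
    exact tendsto_const_nhds
  · lift m to ℕ using hm
    simp only [coeff_toL_natCast]
    exact h m

theorem hasDerivAt_coeff_toL {F : ℝ → PowerSeries ℂ} {G : PowerSeries ℂ} {t : ℝ}
    (h : ∀ i, HasDerivAt (fun t => PowerSeries.coeff i (F t)) (PowerSeries.coeff i G) t) (m : ℤ) :
    HasDerivAt (fun t => (toL (F t)).coeff m) ((toL G).coeff m) t := by
  rcases lt_or_ge m 0 with hm | hm
  · simp only [coeff_toL_of_neg _ hm]
    exact hasDerivAt_const _ _
  · lift m to ℕ using hm
    simp only [coeff_toL_natCast]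
    exact h m

/-- Gaussian elimination of a convergent family with respect to a convergent triangular system. -/
theorem exists_elimination {ι : Type*} {l : Filter ι} (v : ℕ → ι → ℤ → ℂ) (v₀ : ℕ → ℤ → ℂ)
    (hv : ∀ i m, Tendsto (fun t => v i t m) l (𝓝 (v₀ i m)))
    (hlead : ∀ i t, v i t (-(i : ℤ)) ≠ 0) (hlead₀ : ∀ i, v₀ i (-(i : ℤ)) ≠ 0)
    (hlow : ∀ (i : ℕ) t (m : ℤ), m < -(i : ℤ) → v i t m = 0) (j : ℕ) (u : ι → ℤ → ℂ)
    (u₀ : ℤ → ℂ) (hu : ∀ m, Tendsto (fun t => u t m) l (𝓝 (u₀ m))) :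
    ∃ (c : ℕ → ι → ℂ) (c₀ : ℕ → ℂ), (∀ i, Tendsto (c i) l (𝓝 (c₀ i))) ∧
      ∀ t (m : ℤ), -(j : ℤ) ≤ m → m < 0 → u t m - ∑ i ∈ Finset.Icc 1 j, c i t * v i t m = 0 := by
  induction j generalizing u u₀ with
  | zero => exact ⟨0, 0, fun _ => tendsto_const_nhds, fun t m h1 h2 => by omega⟩
  | succ j ih =>
    let d : ι → ℂ := fun t => u t (-((j + 1 : ℕ) : ℤ)) / v (j + 1) t (-((j + 1 : ℕ) : ℤ))
    have hd : Tendsto d l (𝓝 (u₀ (-((j + 1 : ℕ) : ℤ)) / v₀ (j + 1) (-((j + 1 : ℕ) : ℤ)))) :=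
      (hu _).div (hv _ _) (hlead₀ _)
    obtain ⟨c, c₀, hc, h⟩ := ih (fun t m => u t m - d t * v (j + 1) t m) _
      (fun m => (hu m).sub (hd.mul (hv (j + 1) m)))
    refine ⟨fun i => if i = j + 1 then d else c i, fun i => if i = j + 1 then
      u₀ (-((j + 1 : ℕ) : ℤ)) / v₀ (j + 1) (-((j + 1 : ℕ) : ℤ)) else c₀ i, ?_, ?_⟩
    · intro i
      by_cases hi : i = j + 1
      · simp only [hi, if_true]
        exact hd
      · simp only [hi, if_false]
        exact hc i
    · intro t m h1 h2
      have hs : ∑ i ∈ Finset.Icc 1 j, (if i = j + 1 then d else c i) t * v i t m =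
          ∑ i ∈ Finset.Icc 1 j, c i t * v i t m := by
        refine Finset.sum_congr rfl fun i hi => ?_
        rw [if_neg (by have := (Finset.mem_Icc.1 hi).2; omega)]
      rw [Finset.sum_Icc_succ_top (by omega), hs]
      simp only [if_true]
      rcases eq_or_lt_of_le h1 with rfl | h1
      -- In the most negative degree only `v (j + 1)` contributes, and `d` was chosen to cancel it.
      · have h0 : ∑ i ∈ Finset.Icc 1 j, c i t * v i t (-((j + 1 : ℕ) : ℤ)) = 0 := by
          refine Finset.sum_eq_zero fun i hi => ?_
          rw [hlow i t _ (by have := (Finset.mem_Icc.1 hi).2; omega), mul_zero]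
        rw [h0, zero_add, div_mul_cancel₀ _ (hlead _ _), sub_self]
      · have := h t m (by push_cast at h1; omega) h2
        linear_combination this

/-! ### The functions `∂_{ja} 𝒮_b` -/

variable {N : ℕ} [NeZero N]

/-- `∂_{ja} 𝒮_b` for the functions `𝒮_b` with coefficients `g b i`. -/
def timeDeriv (g : Idx N → ℕ → Point N → ℂ) (j : ℕ+) (a : Idx N) (x : Point N) (b : Idx N) :
    LaurentSeries ℂ :=
  toL (PowerSeries.mk fun i => lineDeriv ℝ (g b i) x (tDir j a 1)) +
    if b = a then HahnSeries.single (-(j : ℤ)) 1 else 0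

/-- The ratio `Ψ_b(x + k ε v) / Ψ_b(x)` of quasi-classical wave functions. -/
def waveRatio (g : Idx N → ℕ → Point N → ℂ) (v : Idx N → ℤ) (ε : ℝ) (x : Point N) (k : ℕ)
    (b : Idx N) : LaurentSeries ℂ :=
  HahnSeries.single (-(k * v b)) (1 : ℂ) *
    toL (expSeries (PowerSeries.mk fun i =>
      (g b i (x + ((k : ℝ) * ε) • sDir v) - g b i x) / (ε : ℂ)))

/-- The first row of the amplitudes for `𝒮_b` with coefficients `g b i`. -/
def waveRow (g : Idx N → ℕ → Point N → ℂ) (ε : ℝ) (x : Point N) (b : Idx N) : LaurentSeries ℂ :=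
  HahnSeries.single (ampOrder b : ℤ) (1 : ℂ) *
    toL (expSeries (PowerSeries.mk fun i => g b i x / (ε : ℂ)))

omit [NeZero N] in
theorem hop_self {a a' : Idx N} (h : a ≠ a') : hop a a' a = 1 := by
  simp [hop, h]

omit [NeZero N] in
theorem hop_nonpos {a a' b : Idx N} (h : b ≠ a) : hop a a' b ≤ 0 := by
  simp only [hop, Pi.sub_apply, Pi.single_apply, if_neg h]
  split_ifs <;> simp

/-! ### The exact identity at fixed `ε` -/

section

variable {ε : ℝ} (hε : 0 < ε) {D : Set (Point N)} (hD : IsDomainZeroCharge D) {n : ℤ}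
  {S Sb : Point N → Op N} (hS : IsTodaSolution ε D S Sb) {g : Idx N → ℕ → Point N → ℂ}
  (hg : ∀ b i, SliceC1 D (g b i))
  (hrow : ∀ x ∈ D, ∀ b m, rowFun (S x) (Sb x) n b m = (waveRow g ε x b).coeff m)
  {x : Point N} (hx : x ∈ D)

include hε hD hS hg hrow hx

/-- Two facts come from one comparison: the derivative of the row given by the flow equals the one
obtained by differentiating its exponential form. The flow is complex differentiable, which gives
complex linearity in `τ` although the action coefficients are only assumed real `C¹`. -/
theorem timeDeriv_mem (j : ℕ+) (a : Idx N) :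
    (∀ (τ : ℂ) b i, lineDeriv ℝ (g b i) x (tDir j a τ) =
      τ * lineDeriv ℝ (g b i) x (tDir j a 1)) ∧
    normMap (waveRow g ε x) (timeDeriv g j a x) ∈ LinearMap.range (rowMap (S x) (Sb x) n) := by
  obtain ⟨dψ, hdψ, hmem⟩ := hS.flow_mem hε.ne' hx j a n
  have hεC : (ε : ℂ) ≠ 0 := by exact_mod_cast hε.ne'
  let A : Idx N → PowerSeries ℂ := fun b => expSeries (PowerSeries.mk fun i => g b i x / (ε : ℂ))
  let G : ℂ → Idx N → PowerSeries ℂ := fun τ b =>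
    PowerSeries.mk fun i => lineDeriv ℝ (g b i) x (tDir j a τ) / (ε : ℂ)
  -- Both derivatives are taken along the real line `t ↦ t τ`, and uniqueness of the derivative
  -- equates them.
  have key : ∀ τ b m, τ * dψ b m =
      (HahnSeries.single (ampOrder b : ℤ) (1 : ℂ) * toL (A b * G τ b)).coeff m := by
    intro τ b m
    have hl : HasDerivAt (fun t : ℝ => (t : ℂ) * τ) τ 0 := by
      simpa using (Complex.ofRealCLM.hasDerivAt (x := (0 : ℝ))).mul_const τ
    have h1 : HasDerivAt (fun t : ℝ => rowFun (S (x + tDir j a (t * τ)))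
        (Sb (x + tDir j a (t * τ))) n b m) (τ * dψ b m) 0 := by
      have := (hdψ b m).scomp_of_eq (0 : ℝ) hl (by simp)
      simpa [Function.comp_def] using this
    have h2 : HasDerivAt (fun t : ℝ => (waveRow g ε (x + t • tDir j a τ) b).coeff m)
        ((HahnSeries.single (ampOrder b : ℤ) (1 : ℂ) * toL (A b * G τ b)).coeff m) 0 := by
      simp only [waveRow, coeff_single_mul_toL]
      refine hasDerivAt_coeff_toL ?_ _
      have hF : ∀ i, HasDerivAt (fun t : ℝ => PowerSeries.coeff i
          (PowerSeries.mk fun i => g b i (x + t • tDir j a τ) / (ε : ℂ)))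
          (PowerSeries.coeff i (G τ b)) 0 := by
        intro i
        simp only [PowerSeries.coeff_mk, G]
        exact ((hg b i).hasLineDerivAt_lineDeriv hD hx (charge_tDir j a τ)).div_const _
      intro i
      have := hasDerivAt_coeff_expSeries hF i
      simp only [zero_smul, add_zero] at this
      exact this
    refine h1.unique (h2.congr_of_eventuallyEq ?_)
    filter_upwards [eventually_line_mem hD hx (charge_tDir j a τ)] with t ht
    rw [tDir_smul, hrow _ ht]
  -- The nonzero amplitude `A b` can be cancelled, so linearity in `τ` passes from the wave function
  -- to its exponent.
  have hGG : ∀ τ b, G τ b = PowerSeries.C τ * G 1 b := by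
    intro τ b
    have h1 : toL (A b * G τ b) = toL (A b * (PowerSeries.C τ * G 1 b)) := by
      rw [show A b * (PowerSeries.C τ * G 1 b) = PowerSeries.C τ * (A b * G 1 b) by ring,
        toL_mul (PowerSeries.C τ), toL_C]
      ext m
      have e1 := key τ b (m + ampOrder b)
      have e2 := key 1 b (m + ampOrder b)
      rw [coeff_single_mul_toL, add_sub_cancel_right] at e1 e2
      rw [coeff_cst_mul, ← e1, ← e2, one_mul]
    exact mul_left_cancel₀ (expSeries_ne_zero _) (toL_injective h1)
  refine ⟨fun τ b i => ?_, ?_⟩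
  · have := congrArg (PowerSeries.coeff i) (hGG τ b)
    simp only [PowerSeries.coeff_C_mul, G, PowerSeries.coeff_mk] at this
    field_simp at this
    exact this
  · convert hmem using 1
    funext b m
    change (waveRow g ε x b * timeDeriv g j a x b).coeff m = _
    have e1 : toL (PowerSeries.mk fun i => lineDeriv ℝ (g b i) x (tDir j a 1)) =
        cst ε * toL (G 1 b) := by
      rw [← toL_C, ← toL_mul]
      congr 1
      ext i
      simp only [PowerSeries.coeff_C_mul, G, PowerSeries.coeff_mk]
      field_simp
    have e2 : waveRow g ε x b * (cst ε * toL (G 1 b)) =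
        cst ε * (HahnSeries.single (ampOrder b : ℤ) (1 : ℂ) * toL (A b * G 1 b)) := by
      rw [waveRow, toL_mul]
      ring
    have e3 := key 1 b m
    rw [one_mul] at e3
    rw [timeDeriv, mul_add, HahnSeries.coeff_add, e1, e2, coeff_cst_mul, ← e3]
    congr 1
    split_ifs
    · rw [mul_comm, coeff_single_mul, hrow x hx, sub_neg_eq_add]
    · simp

-- The quotient of the exponentials at `x + k ε v` and at `x` is the exponential of the difference;
-- the translation by `k v_b` in the shifted row is the monomial prefactor.
omit hε hD hg hx in
theorem waveRatio_mem (a a' : Idx N) (k : ℕ)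
    (hk : ∀ i ≤ k, x + ((i : ℝ) * ε) • sDir (hop a a') ∈ D) :
    normMap (waveRow g ε x) (waveRatio g (hop a a') ε x k) ∈
      LinearMap.range (rowMap (S x) (Sb x) n) := by
  have h := hS.shift_mem a a' n k hk (one_row_mem _ _ n)
  convert h using 1
  funext b m
  change (waveRow g ε x b * waveRatio g (hop a a') ε x k b).coeff m = _
  rw [hrow _ (hk k le_rfl)]
  have e : waveRow g ε x b * waveRatio g (hop a a') ε x k b =
      HahnSeries.single (-(k * hop a a' b)) (1 : ℂ) *
        waveRow g ε (x + ((k : ℝ) * ε) • sDir (hop a a')) b := by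
    have e1 : (PowerSeries.mk fun i => g b i (x + ((k : ℝ) * ε) • sDir (hop a a')) / (ε : ℂ)) =
        (PowerSeries.mk fun i => g b i x / (ε : ℂ)) + PowerSeries.mk fun i =>
          (g b i (x + ((k : ℝ) * ε) • sDir (hop a a')) - g b i x) / (ε : ℂ) := by
      ext i
      simp only [map_add, PowerSeries.coeff_mk]
      ring
    simp only [waveRow, waveRatio]
    rw [e1, expSeries_add, toL_mul]
    ring
  rw [e, coeff_single_mul, sub_neg_eq_add]

/-- The coefficients are fixed by the pole at `a` and by the constant term at `1` alone. Uniqueness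
in the space of rows then forces the identity at all other indices `b` and in all other degrees. -/
theorem timeDeriv_eq_sum (j : ℕ+) (a a' : Idx N) (haa' : a ≠ a')
    (hk : ∀ i ≤ (j : ℕ), x + ((i : ℝ) * ε) • sDir (hop a a') ∈ D) (c : ℕ → ℂ) (c₀ : ℂ)
    (hc : ∀ m : ℤ, -(j : ℤ) ≤ m → m < 0 → (timeDeriv g j a x a).coeff m -
      ∑ i ∈ Finset.Icc 1 (j : ℕ), c i * (waveRatio g (hop a a') ε x i a).coeff m = 0)
    (hc₀ : c₀ = (timeDeriv g j a x (one N)).coeff 0 -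
      ∑ i ∈ Finset.Icc 1 (j : ℕ), c i * (waveRatio g (hop a a') ε x i (one N)).coeff 0)
    (b : Idx N) : timeDeriv g j a x b =
      ∑ i ∈ Finset.Icc 1 (j : ℕ), cst (c i) * waveRatio g (hop a a') ε x i b + cst c₀ := by
  -- The constant is carried by the ratio with `k = 0`, which is identically `1`, so that `u`
  -- visibly lies in the space of rows.
  let u : Idx N → LaurentSeries ℂ := timeDeriv g j a x -
    ∑ i ∈ Finset.Icc 1 (j : ℕ), c i • waveRatio g (hop a a') ε x i -
      c₀ • waveRatio g (hop a a') ε x 0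
  have hone : ∀ b, waveRatio g (hop a a') ε x 0 b = 1 := by
    intro b
    have : (PowerSeries.mk fun i : ℕ => (0 : ℂ)) = 0 := by ext; simp
    simp [waveRatio, this, expSeries_zero]
  have hsm : ∀ (z : ℂ) (F : LaurentSeries ℂ), z • F = cst z * F := fun z F =>
    HahnSeries.C_mul_eq_smul.symm
  have hub : ∀ b, u b = timeDeriv g j a x b -
      ∑ i ∈ Finset.Icc 1 (j : ℕ), cst (c i) * waveRatio g (hop a a') ε x i b - cst c₀ := by
    intro b
    simp only [u, Pi.sub_apply, Finset.sum_apply, Pi.smul_apply, hone, hsm, mul_one]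
  have hu0 : u = 0 := by
    refine eq_zero_of_normMap_mem (hS.minus x hx) (hS.plus x hx) (n := n)
      (A := fun b => expSeries (PowerSeries.mk fun i => g b i x / (ε : ℂ)))
      (fun b => expSeries_ne_zero _) ?_ ?_ ?_
    · change normMap (waveRow g ε x) u ∈ _
      simp only [u, map_sub, map_sum, map_smul]
      refine Submodule.sub_mem _ (Submodule.sub_mem _ (timeDeriv_mem hε hD hS hg hrow hx j a).2
        (Submodule.sum_mem _ fun i hi => Submodule.smul_mem _ _
          (waveRatio_mem hS hrow a a' i fun k hki =>
            hk k (hki.trans (Finset.mem_Icc.1 hi).2)))) (Submodule.smul_mem _ _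
          (waveRatio_mem hS hrow a a' 0 fun k hki => hk k (hki.trans (Nat.zero_le _))))
    · intro b m hm
      have hcst : (cst c₀).coeff m = 0 := by
        rw [← toL_C, coeff_toL_of_neg _ hm]
      rw [hub, HahnSeries.coeff_sub, HahnSeries.coeff_sub, HahnSeries.coeff_sum, hcst, sub_zero]
      simp only [coeff_cst_mul]
      -- At `a`, degrees below `-j` are out of reach of every term and the degrees from `-j` to `-1`
      -- are cancelled by `c`; at the other indices neither the derivative nor the ratios have a
      -- pole.
      by_cases hb : b = a
      · subst hb
        rcases lt_or_ge m (-(j : ℤ)) with hmj | hmj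
        · have h1 : (timeDeriv g j b x b).coeff m = 0 := by
            rw [timeDeriv, if_pos rfl, HahnSeries.coeff_add, coeff_toL_of_neg _ hm,
              HahnSeries.coeff_single_of_ne (by omega), add_zero]
          rw [h1, zero_sub, neg_eq_zero]
          refine Finset.sum_eq_zero fun i hi => ?_
          have := (Finset.mem_Icc.1 hi).2
          rw [waveRatio, coeff_single_mul_toL, hop_self haa', coeff_toL_of_neg _ (by omega),
            mul_zero]
        · exact hc m hmj hm
      · have h1 : (timeDeriv g j a x b).coeff m = 0 := by
          rw [timeDeriv, if_neg hb, add_zero, coeff_toL_of_neg _ hm]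
        rw [h1, zero_sub, neg_eq_zero]
        refine Finset.sum_eq_zero fun i hi => ?_
        have h2 := hop_nonpos (a' := a') hb
        have h3 : (i : ℤ) * hop a a' b ≤ 0 := mul_nonpos_of_nonneg_of_nonpos (by positivity) h2
        rw [waveRatio, coeff_single_mul_toL, coeff_toL_of_neg _ (by omega), mul_zero]
    · rw [hub, HahnSeries.coeff_sub, HahnSeries.coeff_sub, HahnSeries.coeff_sum]
      simp only [coeff_cst_mul]
      rw [coeff_cst_zero, hc₀, sub_self]
  have := hub b
  rw [hu0, Pi.zero_apply] at this
  linear_combination -this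

end

/-! ### The limit -/

theorem expSeries_natCast_mul (k : ℕ) (F : PowerSeries ℂ) :
    expSeries (PowerSeries.C (k : ℂ) * F) = expSeries F ^ k := by
  induction k with
  | zero => simp [expSeries_zero]
  | succ k ih =>
    rw [pow_succ, ← ih, ← expSeries_add]
    congr 1
    push_cast
    rw [map_add, map_one]
    ring

omit [NeZero N] in
theorem expDeriv_pow (g : Idx N → ℕ → Point N → ℂ) (v : Idx N → ℤ) (b : Idx N) (x : Point N)
    (k : ℕ) : expDeriv g v b x ^ k = HahnSeries.single (-(k * v b)) (1 : ℂ) *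
      toL (expSeries (PowerSeries.mk fun i => (k : ℂ) * lineDeriv ℝ (g b i) x (sDir v))) := by
  have e : (PowerSeries.mk fun i => (k : ℂ) * lineDeriv ℝ (g b i) x (sDir v)) =
      PowerSeries.C (k : ℂ) * PowerSeries.mk fun i => lineDeriv ℝ (g b i) x (sDir v) := by
    ext i
    rw [PowerSeries.coeff_C_mul, PowerSeries.coeff_mk, PowerSeries.coeff_mk]
  rw [e, expSeries_natCast_mul, toL_pow, expDeriv, mul_pow, HahnSeries.single_pow, one_pow]
  congr 2
  simp

variable {E : Set ℝ} (hEpos : ∀ ε ∈ E, 0 < ε) (hE : (𝓝[E] (0 : ℝ)).NeBot) {D : Set (Point N)}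
  (hD : IsDomainZeroCharge D) {n : ℝ → ℤ} {S Sb : ℝ → Point N → Op N}
  (hS : ∀ ε ∈ E, IsTodaSolution ε D (S ε) (Sb ε)) {act : Idx N → ℕ → ℝ → Point N → ℂ}
  {act₀ : Idx N → ℕ → Point N → ℂ} (hact : IsQuasiClassical E D n S Sb act act₀)
  {x : Point N} (hx : x ∈ D)

include hEpos hE hD hS hact hx

/-- Complex linearity holds for each `ε` and is a closed condition under convergence of first
derivatives. -/
theorem lineDeriv_limit_tDir (j : ℕ+) (a : Idx N) (τ : ℂ) (b : Idx N) (i : ℕ) :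
    lineDeriv ℝ (act₀ b i) x (tDir j a τ) = τ * lineDeriv ℝ (act₀ b i) x (tDir j a 1) := by
  have h := fun τ => tendsto_lineDeriv hD hx (fun ε hε => hact.contDiffOn ε hε b i)
    (hact.contDiffOn_limit b i) (hact.tendsto_fderiv b i) (charge_tDir j a τ)
  refine tendsto_nhds_unique (h τ) (((h 1).const_mul τ).congr' ?_)
  filter_upwards [self_mem_nhdsWithin] with ε hε
  refine ((timeDeriv_mem (hEpos ε hε) hD (hS ε hε) (g := fun b i => act b i ε) (n := n ε)
    (fun b i => hact.contDiffOn ε hε b i) (fun y hy b m => ?_) hx j a).1 τ b i).symm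
  rw [rowFun_eq_coeff ((hS ε hε).minus y hy) ((hS ε hε).plus y hy), hact.wave ε hε y hy]
  rfl

/-- Limit of `timeDeriv_eq_sum`: the `k`-step ratio tends to the `k`-th power of the exponential
derivative, since the difference quotient tends to `k` times the derivative. It is essential that
`c` and `c₀` do not depend on `b`. -/
theorem exists_timeDeriv_eq (j : ℕ+) (a a' : Idx N) (haa' : a ≠ a') :
    ∃ (c : ℕ → ℂ) (c₀ : ℂ), ∀ b, timeDeriv act₀ j a x b =
      ∑ i ∈ Finset.Icc 1 (j : ℕ), cst (c i) * expDeriv act₀ (hop a a') b x ^ i + cst c₀ := by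
  have hu : ∀ b m, Tendsto (fun ε => (timeDeriv (fun b i => act b i ε) j a x b).coeff m) (𝓝[E] 0)
      (𝓝 ((timeDeriv act₀ j a x b).coeff m)) := by
    intro b m
    simp only [timeDeriv, HahnSeries.coeff_add]
    refine (tendsto_coeff_toL (fun i => ?_) m).add_const _
    simp only [PowerSeries.coeff_mk]
    exact tendsto_lineDeriv hD hx (fun ε hε => hact.contDiffOn ε hε b i)
      (hact.contDiffOn_limit b i) (hact.tendsto_fderiv b i) (charge_tDir j a 1)
  have hv : ∀ b (k : ℕ) m,
      Tendsto (fun ε => (waveRatio (fun b i => act b i ε) (hop a a') ε x k b).coeff m) (𝓝[E] 0)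
        (𝓝 ((expDeriv act₀ (hop a a') b x ^ k).coeff m)) := by
    intro b k m
    rw [expDeriv_pow]
    simp only [waveRatio, coeff_single_mul_toL]
    refine tendsto_coeff_toL (tendsto_coeff_expSeries fun i => ?_) _
    simp only [PowerSeries.coeff_mk]
    exact tendsto_difference_quotient hD hx hEpos (fun ε hε => hact.contDiffOn ε hε b i)
      (hact.contDiffOn_limit b i) (hact.tendsto_fderiv b i) (charge_sDir_hop a a') k
  have hlead : ∀ (k : ℕ) (F : PowerSeries ℂ),
      (HahnSeries.single (-(k * hop a a' a)) (1 : ℂ) * toL (expSeries F)).coeff (-(k : ℤ)) ≠ 0 := by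
    intro k F
    have h0 := coeff_toL_natCast (expSeries F) 0
    rw [Nat.cast_zero, PowerSeries.coeff_zero_eq_constantCoeff, constantCoeff_expSeries] at h0
    rw [coeff_single_mul_toL, hop_self haa', mul_one, sub_neg_eq_add, neg_add_cancel, h0]
    exact Complex.exp_ne_zero _
  -- The diagonal entries are exponentials, both for positive `ε` and in the limit, so the
  -- elimination coefficients converge.
  obtain ⟨c, c₀, hc, h⟩ := exists_elimination (l := 𝓝[E] (0 : ℝ))
    (fun k ε => (waveRatio (fun b i => act b i ε) (hop a a') ε x k a).coeff)
    (fun k => (expDeriv act₀ (hop a a') a x ^ k).coeff) (hv a) (fun k ε => hlead k _)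
    (fun k => by rw [expDeriv_pow]; exact hlead k _)
    (fun k ε m hm => by
      rw [waveRatio, coeff_single_mul_toL, hop_self haa', coeff_toL_of_neg _ (by omega)])
    (j : ℕ) (fun ε => (timeDeriv (fun b i => act b i ε) j a x a).coeff) _ (hu a)
  let d : ℝ → ℂ := fun ε => (timeDeriv (fun b i => act b i ε) j a x (one N)).coeff 0 -
    ∑ i ∈ Finset.Icc 1 (j : ℕ),
      c i ε * (waveRatio (fun b i => act b i ε) (hop a a') ε x i (one N)).coeff 0
  obtain ⟨d₀, hd⟩ : ∃ d₀, Tendsto d (𝓝[E] 0) (𝓝 d₀) :=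
    ⟨_, (hu (one N) 0).sub (tendsto_finsetSum _ fun i _ => (hc i).mul (hv (one N) i 0))⟩
  refine ⟨c₀, d₀, fun b => ?_⟩
  ext m
  refine tendsto_nhds_unique (hu b m) ?_
  rw [HahnSeries.coeff_add, HahnSeries.coeff_sum]
  simp only [coeff_cst_mul]
  have hcstc : ∀ z : ℂ, (cst z).coeff m = z * (1 : LaurentSeries ℂ).coeff m := fun z => by
    rw [← coeff_cst_mul, mul_one]
  rw [hcstc]
  refine Tendsto.congr' ?_ ((tendsto_finsetSum _ fun i _ => (hc i).mul (hv b i m)).add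
    (hd.mul_const _))
  -- Iterated shifts require all intermediate points to lie in `D`; for fixed `j` there are finitely
  -- many of them and `D` is open along the line.
  have hsmall : ∀ᶠ ε in 𝓝[E] (0 : ℝ), ∀ i ∈ Finset.range ((j : ℕ) + 1),
      x + ((i : ℝ) * ε) • sDir (hop a a') ∈ D := by
    rw [Filter.eventually_all_finset]
    intro i _
    have ht : Tendsto (fun ε : ℝ => (i : ℝ) * ε) (𝓝[E] 0) (𝓝 0) := by
      have h : Continuous (fun ε : ℝ => (i : ℝ) * ε) := by fun_prop
      simpa using (h.tendsto 0).mono_left (nhdsWithin_le_nhds (s := E))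
    exact ht.eventually (eventually_line_mem hD hx (charge_sDir_hop a a'))
  filter_upwards [self_mem_nhdsWithin, hsmall] with ε hε hmem
  have hfin := timeDeriv_eq_sum (hEpos ε hε) hD (hS ε hε) (g := fun b i => act b i ε) (n := n ε)
    (fun b i => hact.contDiffOn ε hε b i)
    (fun y hy b m => by
      rw [rowFun_eq_coeff ((hS ε hε).minus y hy) ((hS ε hε).plus y hy), hact.wave ε hε y hy]
      rfl) hx j a a' haa'
    (fun i hi => hmem i (Finset.mem_range.2 (by omega))) (fun i => c i ε) (d ε) (h ε) rfl b
  rw [hfin, HahnSeries.coeff_add, HahnSeries.coeff_sum, hcstc]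
  simp only [coeff_cst_mul]

end
end TodaWhitham

namespace TodaWhitham
noncomputable section

/-! ### Local parameters -/

theorem cst_zero : cst 0 = 0 := map_zero _
theorem cst_neg (c : ℂ) : cst (-c) = -cst c := map_neg _ _
theorem cst_sum {ι : Type*} (s : Finset ι) (c : ι → ℂ) : cst (∑ i ∈ s, c i) = ∑ i ∈ s, cst (c i) :=
  map_sum _ _ _

theorem coeff_cst_of_ne (c : ℂ) {m : ℤ} (hm : m ≠ 0) : (cst c).coeff m = 0 :=
  HahnSeries.coeff_single_of_ne hm

theorem ne_zero_of_coeff_one {f : PowerSeries ℂ} (h : PowerSeries.coeff 1 f ≠ 0) : f ≠ 0 := by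
  rintro rfl
  simp at h

theorem toL_X : toL PowerSeries.X = HahnSeries.single (1 : ℤ) (1 : ℂ) :=
  HahnSeries.ofPowerSeries_X

theorem exists_eq_X_mul {f : PowerSeries ℂ} (h : PowerSeries.constantCoeff f = 0) :
    ∃ F : PowerSeries ℂ, f = PowerSeries.X * F ∧
      PowerSeries.constantCoeff F = PowerSeries.coeff 1 f := by
  obtain ⟨F, rfl⟩ := PowerSeries.X_dvd_iff.2 h
  refine ⟨F, rfl, ?_⟩
  rw [← zero_add 1, PowerSeries.coeff_succ_X_mul, PowerSeries.coeff_zero_eq_constantCoeff_apply]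

theorem toL_inv {f : PowerSeries ℂ} (h : PowerSeries.constantCoeff f ≠ 0) :
    toL f⁻¹ = (toL f)⁻¹ := by
  refine eq_inv_of_mul_eq_one_left ?_
  rw [← toL_mul, PowerSeries.inv_mul_cancel _ h, toL_one]

theorem single_one_inv : (HahnSeries.single (1 : ℤ) (1 : ℂ))⁻¹ =
    (HahnSeries.single (-1 : ℤ) (1 : ℂ)) := by
  have := single_zpow_one (-1)
  rwa [zpow_neg_one] at this

/-- The reciprocals of two local parameters are proportional up to a regular term. -/
theorem exists_inv_eq {f z : PowerSeries ℂ} (hf : PowerSeries.constantCoeff f = 0)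
    (hf1 : PowerSeries.coeff 1 f ≠ 0) (hz : PowerSeries.constantCoeff z = 0)
    (hz1 : PowerSeries.coeff 1 z ≠ 0) : ∃ K : PowerSeries ℂ, (toL f)⁻¹ =
      cst (PowerSeries.coeff 1 z / PowerSeries.coeff 1 f) * (toL z)⁻¹ + toL K := by
  obtain ⟨F, rfl, hF⟩ := exists_eq_X_mul hf
  obtain ⟨Z, rfl, hZ⟩ := exists_eq_X_mul hz
  rw [← hF] at hf1 ⊢
  rw [← hZ] at hz1 ⊢
  -- The ratio of leading coefficients makes this difference vanish at the origin; the resulting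
  -- factor `X` cancels the simple pole.
  have h0 : PowerSeries.constantCoeff (F⁻¹ - PowerSeries.C (PowerSeries.constantCoeff Z /
      PowerSeries.constantCoeff F) * Z⁻¹) = 0 := by
    simp only [map_sub, map_mul, PowerSeries.constantCoeff_C, PowerSeries.constantCoeff_inv]
    field_simp
    ring
  obtain ⟨K, hK⟩ := PowerSeries.X_dvd_iff.2 h0
  refine ⟨K, ?_⟩
  have h1 := congrArg toL hK
  rw [toL_sub, toL_mul, toL_mul, toL_C, toL_inv hf1, toL_inv hz1, toL_X] at h1
  have hX : HahnSeries.single (1 : ℤ) (1 : ℂ) ≠ 0 := by simp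
  rw [toL_mul, toL_mul, toL_X, mul_inv, mul_inv]
  have e : toL K = (HahnSeries.single (1 : ℤ) (1 : ℂ))⁻¹ *
      (HahnSeries.single (1 : ℤ) (1 : ℂ) * toL K) := by
    rw [inv_mul_cancel_left₀ hX]
  rw [e, ← h1]
  ring

/-- Every power series is a power series in a given local parameter. -/
theorem exists_subst_eq {z : PowerSeries ℂ} (hz : PowerSeries.constantCoeff z = 0)
    (hz1 : PowerSeries.coeff 1 z ≠ 0) (g : PowerSeries ℂ) :
    ∃ h : PowerSeries ℂ, h.subst z = g ∧
      PowerSeries.constantCoeff h = PowerSeries.constantCoeff g := by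
  have hu : IsUnit (PowerSeries.coeff 1 z) := hz1.isUnit
  refine ⟨g.subst (z.substInvOfIsUnit hu), ?_, ?_⟩
  · rw [PowerSeries.subst_comp_subst_apply (PowerSeries.HasSubst.substInvOfIsUnit z hu)
      (PowerSeries.HasSubst.of_constantCoeff_zero' hz),
      PowerSeries.subst_substInvOfIsUnit_left z hz hu, PowerSeries.X_subst]
  · exact constantCoeff_subst_of_zero (PowerSeries.constantCoeff_substInvOfIsUnit z hu) g

theorem eq_of_subst_eq_X {Q f f' : PowerSeries ℂ} (hQ : PowerSeries.constantCoeff Q = 0)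
    (hQ1 : PowerSeries.coeff 1 Q ≠ 0) (hf : PowerSeries.constantCoeff f = 0)
    (hf' : PowerSeries.constantCoeff f' = 0) (h : Q.subst f = PowerSeries.X)
    (h' : Q.subst f' = PowerSeries.X) : f' = f := by
  obtain ⟨k, hk, -⟩ := exists_subst_eq hQ hQ1 PowerSeries.X
  have aux : ∀ f : PowerSeries ℂ, PowerSeries.constantCoeff f = 0 →
      Q.subst f = PowerSeries.X → f = k := by
    intro f hf h
    have e := congrArg (PowerSeries.subst f) hk
    rw [PowerSeries.subst_comp_subst_apply (PowerSeries.HasSubst.of_constantCoeff_zero' hQ)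
      (PowerSeries.HasSubst.of_constantCoeff_zero' hf), h, PowerSeries.X_subst,
      PowerSeries.subst_X (PowerSeries.HasSubst.of_constantCoeff_zero' hf)] at e
    exact e.symm
  rw [aux f hf h, aux f' hf' h']

/-- Composition with `0` is formally allowed by `compL` but yields only a constant. This excludes
`0` as a candidate Lax function. -/
theorem compL_zero_right_coeff (F : LaurentSeries ℂ) {m : ℤ} (hm : m ≠ 0) :
    (compL F 0).coeff m = 0 := by
  rw [compL, toL_zero]
  have h : toL (F.powerSeriesPart.subst (0 : PowerSeries ℂ)) =
      cst (PowerSeries.constantCoeff F.powerSeriesPart) := by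
    rw [← toL_C]
    congr 1
    exact PowerSeries.subst_zero_eq_C_constantCoeff
  rw [h]
  rcases eq_or_ne F.order 0 with h0 | h0
  · rw [h0, zpow_zero, one_mul]
    exact HahnSeries.coeff_single_of_ne hm
  · rw [zero_zpow _ h0, zero_mul]
    rfl

/-- The Euler operator `w ∂/∂w` on coefficients. -/
theorem coeff_single_mul_hasseDeriv (F : LaurentSeries ℂ) (i : ℤ) :
    (HahnSeries.single (1 : ℤ) (1 : ℂ) * LaurentSeries.hasseDeriv ℂ 1 F).coeff i =
      i * F.coeff i := by
  rw [coeff_single_mul, LaurentSeries.hasseDeriv_coeff]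
  simp

variable {N : ℕ} [NeZero N]

theorem pLocal_coeff_ne (a : Idx N) (q : ℂ) : ∃ m ≠ 0, (pLocal a q).coeff m ≠ 0 := by
  unfold pLocal
  split_ifs with h
  · exact ⟨-1, by norm_num, by simp⟩
  · refine ⟨1, one_ne_zero, ?_⟩
    rw [HahnSeries.coeff_add, HahnSeries.coeff_single_same, coeff_cst_of_ne _ one_ne_zero]
    simp

theorem one_ne_oneBar : one N ≠ oneBar N := by simp [one, oneBar]

theorem constantCoeff_zInv (ρ : Idx N → ℂ) (a : Idx N) :
    PowerSeries.constantCoeff (zInv ρ a) = 0 := by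
  unfold zInv
  split_ifs <;> simp

theorem coeff_one_zInv (ρ : Idx N → ℂ) (a : Idx N) : PowerSeries.coeff 1 (zInv ρ a) =
    if a = one N ∨ a = oneBar N then 1 else (-ρ a)⁻¹ := by
  unfold zInv
  split_ifs
  · simp
  · rw [show (1 : ℕ) = 0 + 1 from rfl, PowerSeries.coeff_succ_X_mul,
      PowerSeries.coeff_zero_eq_constantCoeff_apply, PowerSeries.constantCoeff_inv]
    simp

theorem coeff_one_zInv_ne {ρ : Idx N → ℂ} (hρ : ∀ a, a ≠ one N → a ≠ oneBar N → ρ a ≠ 0)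
    (a : Idx N) : PowerSeries.coeff 1 (zInv ρ a) ≠ 0 := by
  rw [coeff_one_zInv]
  split_ifs with h
  · exact one_ne_zero
  · push Not at h
    exact inv_ne_zero (neg_ne_zero.2 (hρ a h.1 h.2))

theorem toL_zInv {ρ : Idx N → ℂ} (hρ : ∀ a, a ≠ one N → a ≠ oneBar N → ρ a ≠ 0) (a : Idx N) :
    toL (zInv ρ a) = (zFun ρ a (pLocal a (puncture ρ a)))⁻¹ := by
  by_cases h1 : a = one N
  · subst h1
    rw [zInv, if_pos (Or.inl rfl), zFun, if_pos rfl, pLocal, if_pos rfl, toL_X, ← single_one_inv,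
      inv_inv]
  by_cases h2 : a = oneBar N
  · subst h2
    rw [zInv, if_pos (Or.inr rfl), zFun, if_neg h1, if_pos rfl, pLocal, if_neg h1, puncture,
      if_pos rfl, toL_X, inv_inv, cst_zero, zero_add]
  · rw [zInv, if_neg (by tauto), zFun, if_neg h1, if_neg h2, pLocal, if_neg h1, puncture,
      if_neg h2, toL_mul, toL_inv (by simpa using hρ a h1 h2), toL_sub, toL_X, toL_C, inv_div,
      cst_neg, neg_add_cancel_comm, div_eq_mul_inv, neg_add_eq_sub]

/-- A ring homomorphism of Laurent series that fixes constants commutes with `zFun`. -/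
theorem map_zFun (φ : LaurentSeries ℂ →+* LaurentSeries ℂ) (hφ : ∀ c, φ (cst c) = cst c)
    (ρ : Idx N → ℂ) (a : Idx N) (p : LaurentSeries ℂ) : φ (zFun ρ a p) = zFun ρ a (φ p) := by
  unfold zFun
  split_ifs
  · rfl
  · exact map_inv₀ φ p
  · rw [map_div₀, map_add, hφ]

/-! ### The projections -/

theorem coeff_neg_sum_single (c : ℕ → ℂ) (j : ℕ) (G : PowerSeries ℂ) {k : ℕ}
    (hk : k ∈ Finset.Icc 1 j) :
    (∑ i ∈ Finset.Icc 1 j, cst (c i) * HahnSeries.single (-(i : ℤ)) (1 : ℂ) + toL G).coeff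
      (-(k : ℤ)) = c k := by
  have hk1 := (Finset.mem_Icc.1 hk).1
  rw [HahnSeries.coeff_add, coeff_toL_of_neg _ (by omega), add_zero, HahnSeries.coeff_sum,
    Finset.sum_eq_single k]
  · rw [coeff_cst_mul, HahnSeries.coeff_single_same, mul_one]
  · intro i _ hi
    rw [coeff_cst_mul, HahnSeries.coeff_single_of_ne (by omega), mul_zero]
  · intro h
    exact absurd hk h

/-- The projections in the parameters `Z_b` and `(p - q_b)⁻¹` agree. -/
theorem exists_sum_zFun_eq (ρ : Idx N → ℂ) {b : Idx N} (hb : b ≠ one N) (c : ℕ → ℂ) (j : ℕ) :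
    ∃ e : ℕ → ℂ, ∀ p : LaurentSeries ℂ, p - cst (puncture ρ b) ≠ 0 →
      ∑ i ∈ Finset.Icc 1 j, cst (c i) *
        (zFun ρ b p ^ i - if b = one N ∨ b = oneBar N then 0 else 1) =
      ∑ i ∈ Finset.Icc 1 j, cst (e i) * ((p - cst (puncture ρ b)) ^ i)⁻¹ := by
  by_cases hb' : b = oneBar N
  · subst hb'
    refine ⟨c, fun p _ => Finset.sum_congr rfl fun i _ => ?_⟩
    rw [zFun, if_neg hb, if_pos rfl, if_pos (Or.inr rfl), puncture, if_pos rfl, cst_zero, sub_zero,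
      sub_zero, inv_pow]
  -- With `y = (p - q_b)⁻¹` one has `Z_b = 1 - ρ_b y`. Hence `Z_b^i - 1` is a polynomial in `y` of
  -- degree at most `i` without constant term, which is why the `1` is subtracted.
  · let R : Polynomial ℂ := ∑ i ∈ Finset.Icc 1 j, Polynomial.C (c i) *
      ((1 + Polynomial.C (-ρ b) * Polynomial.X) ^ i - 1)
    have hR0 : R.coeff 0 = 0 := by
      rw [Polynomial.coeff_zero_eq_eval_zero]
      simp [R, Polynomial.eval_finsetSum]
    have hRd : R.natDegree < j + 1 := by
      refine Nat.lt_succ_of_le (Polynomial.natDegree_sum_le_of_forall_le _ _ fun i hi => ?_)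
      refine (Polynomial.natDegree_C_mul_le _ _).trans ?_
      refine (Polynomial.natDegree_sub_le _ _).trans (max_le ?_ (by simp))
      refine Polynomial.natDegree_pow_le.trans ?_
      have h1 : (1 + Polynomial.C (-ρ b) * Polynomial.X : Polynomial ℂ).natDegree ≤ 1 := by
        refine (Polynomial.natDegree_add_le _ _).trans (max_le (by simp) ?_)
        exact (Polynomial.natDegree_C_mul_le _ _).trans Polynomial.natDegree_X_le
      exact (Nat.mul_le_mul_left i h1).trans (by simpa using (Finset.mem_Icc.1 hi).2)
    refine ⟨fun i => R.coeff i, fun p hp => ?_⟩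
    rw [puncture, if_neg hb'] at hp ⊢
    set y := (p - cst (-ρ b))⁻¹ with hy
    have hz : zFun ρ b p = 1 + cst (-ρ b) * y := by
      rw [zFun, if_neg hb, if_neg hb', hy]
      rw [cst_neg, sub_neg_eq_add] at hp ⊢
      field_simp
      ring
    have h1 : R.eval₂ HahnSeries.C y = ∑ i ∈ Finset.Icc 1 j, cst (c i) *
        (zFun ρ b p ^ i - if b = one N ∨ b = oneBar N then 0 else 1) := by
      rw [if_neg (by tauto), hz]
      simp only [R, Polynomial.eval₂_finsetSum, Polynomial.eval₂_mul, Polynomial.eval₂_pow,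
        Polynomial.eval₂_sub, Polynomial.eval₂_C, Polynomial.eval₂_add, Polynomial.eval₂_one,
        Polynomial.eval₂_X]
    rw [← h1, Polynomial.eval₂_eq_sum_range' _ hRd, Finset.range_eq_Ico,
      Finset.sum_eq_sum_Ico_succ_bot (by omega), hR0, map_zero, zero_mul, zero_add]
    refine Finset.sum_congr rfl fun i _ => ?_
    rw [hy, inv_pow]

/-- The polar coefficients in the local parameter are read off after rewriting powers of `Z_b`
through `(p - q_b)⁻¹`. That rewriting uses coefficients independent of `p`, so it applies both to
the local expansion at the puncture and to an arbitrary `p`. -/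
theorem whithamOmega_eq (ρ : Idx N → ℂ) (b : Idx N) (f : PowerSeries ℂ) (j : ℕ+) (c : ℕ → ℂ)
    (G : PowerSeries ℂ)
    (h : toL f ^ (-(j : ℤ)) = ∑ i ∈ Finset.Icc 1 (j : ℕ), cst (c i) *
      zFun ρ b (pLocal b (puncture ρ b)) ^ i + toL G)
    {p : LaurentSeries ℂ} (hp : b ≠ one N → p - cst (puncture ρ b) ≠ 0) :
    whithamOmega b (puncture ρ b) f j p =
      ∑ i ∈ Finset.Icc 1 (j : ℕ), cst (c i) *
        (zFun ρ b p ^ i - if b = one N ∨ b = oneBar N then 0 else 1) +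
      if b = one N then cst (PowerSeries.constantCoeff G) else 0 := by
  by_cases hb : b = one N
  · subst hb
    have h' : toL f ^ (-(j : ℤ)) = ∑ i ∈ Finset.Icc 1 (j : ℕ), cst (c i) *
        HahnSeries.single (-(i : ℤ)) (1 : ℂ) + toL G := by
      rw [h]
      congr 1
      refine Finset.sum_congr rfl fun i _ => ?_
      rw [zFun, if_pos rfl, pLocal, if_pos rfl, HahnSeries.single_pow, one_pow]
      simp
    have h0 : (toL f ^ (-(j : ℤ))).coeff (-((0 : ℕ) : ℤ)) = PowerSeries.constantCoeff G := by
      rw [h', HahnSeries.coeff_add, HahnSeries.coeff_sum, Finset.sum_eq_zero, zero_add,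
        Nat.cast_zero, neg_zero, ← Nat.cast_zero, coeff_toL_natCast,
        PowerSeries.coeff_zero_eq_constantCoeff_apply]
      intro i hi
      have := (Finset.mem_Icc.1 hi).1
      rw [coeff_cst_mul, HahnSeries.coeff_single_of_ne (by omega), mul_zero]
    rw [whithamOmega, if_pos rfl, if_pos rfl, if_pos (Or.inl rfl), zFun, if_pos rfl,
      Finset.range_eq_Ico, Finset.sum_eq_sum_Ico_succ_bot (by omega), h0, pow_zero, mul_one,
      add_comm]
    congr 1
    refine Finset.sum_congr rfl fun i hi => ?_
    rw [h', coeff_neg_sum_single c j G hi, sub_zero]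
  · obtain ⟨e, he⟩ := exists_sum_zFun_eq ρ hb c j
    have h1 : pLocal b (puncture ρ b) - cst (puncture ρ b) = HahnSeries.single (1 : ℤ) (1 : ℂ) := by
      rw [pLocal, if_neg hb, add_sub_cancel_left]
    have h2 := he (pLocal b (puncture ρ b)) (by rw [h1]; simp)
    rw [h1] at h2
    have h3 : toL f ^ (-(j : ℤ)) = ∑ i ∈ Finset.Icc 1 (j : ℕ), cst (e i) *
        HahnSeries.single (-(i : ℤ)) (1 : ℂ) +
        toL (PowerSeries.C (∑ i ∈ Finset.Icc 1 (j : ℕ), c i *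
          if b = one N ∨ b = oneBar N then 0 else 1) + G) := by
      have h4 : ∑ i ∈ Finset.Icc 1 (j : ℕ), cst (e i) * HahnSeries.single (-(i : ℤ)) (1 : ℂ) =
          ∑ i ∈ Finset.Icc 1 (j : ℕ), cst (e i) * (HahnSeries.single (1 : ℤ) (1 : ℂ) ^ i)⁻¹ := by
        refine Finset.sum_congr rfl fun i _ => ?_
        rw [← single_zpow_one, zpow_neg, zpow_natCast]
      rw [h4, ← h2, h, toL_add, toL_C, ← add_assoc, cst_sum, ← Finset.sum_add_distrib]
      congr 1
      refine Finset.sum_congr rfl fun i _ => ?_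
      split_ifs <;> simp [mul_sub]
    rw [he p (hp hb), whithamOmega, if_neg hb, if_neg hb, add_zero]
    refine Finset.sum_congr rfl fun i hi => ?_
    rw [h3, coeff_neg_sum_single e j _ hi]

end
end TodaWhitham

namespace TodaWhitham
noncomputable section

variable {N : ℕ}

/-! ### Time derivatives of the functions `𝒮_{b,0}` -/

theorem coeff_finsupp_sum {α : Type*} (t : α →₀ ℂ) (F : α → ℂ → LaurentSeries ℂ) (i : ℤ) :
    (t.sum F).coeff i = t.sum fun k c => (F k c).coeff i := by
  rw [Finsupp.sum, HahnSeries.coeff_sum]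
  rfl

theorem coeff_actionL_of_nonneg (g : Idx N → ℕ → Point N → ℂ) (b : Idx N) (x : Point N) (i : ℕ) :
    (actionL g b x).coeff i = g b i x := by
  rw [actionL, HahnSeries.coeff_add, coeff_toL_natCast, PowerSeries.coeff_mk, coeff_finsupp_sum,
    Finsupp.sum, Finset.sum_eq_zero, zero_add]
  intro jb _
  have := jb.1.pos
  split_ifs
  · rw [HahnSeries.coeff_single_of_ne (by omega)]
  · rfl

theorem coeff_actionL_neg (g : Idx N → ℕ → Point N → ℂ) (b : Idx N) (x : Point N) (k : ℕ+) :
    (actionL g b x).coeff (-(k : ℤ)) = x.2 (k, b) := by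
  have hk := k.pos
  rw [actionL, HahnSeries.coeff_add, coeff_toL_of_neg _ (by omega), add_zero, coeff_finsupp_sum,
    Finsupp.sum, Finset.sum_eq_single (k, b)]
  · rw [if_pos rfl, HahnSeries.coeff_single_same]
  · intro jb _ hne
    split_ifs with h
    · refine HahnSeries.coeff_single_of_ne fun h' => hne ?_
      ext1
      · exact PNat.coe_injective (by change (jb.1 : ℕ) = (k : ℕ); omega)
      · exact h
    · rfl
  · intro h
    rw [if_pos rfl, HahnSeries.coeff_single_same]
    simpa using h

theorem exists_natCast_or_neg (i : ℤ) : (∃ k : ℕ, i = k) ∨ ∃ k : ℕ+, i = -(k : ℤ) := by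
  rcases le_or_gt 0 i with h | h
  · exact Or.inl (Int.eq_ofNat_of_zero_le h)
  · exact Or.inr ⟨⟨(-i).toNat, by omega⟩, by simp only [PNat.mk_coe]; omega⟩

theorem hasTimeDeriv_actionL {g : Idx N → ℕ → Point N → ℂ} {j : ℕ+} {a b : Idx N} {x : Point N}
    (h : ∀ i, HasDerivAt (fun τ : ℂ => g b i (x + tDir j a τ))
      (lineDeriv ℝ (g b i) x (tDir j a 1)) 0) :
    HasTimeDeriv (actionL g b) (timeDeriv g j a x b) j a x := by
  intro i
  rcases exists_natCast_or_neg i with ⟨k, rfl⟩ | ⟨k, rfl⟩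
  · simp only [coeff_actionL_of_nonneg]
    convert h k using 1
    have := j.pos
    rw [timeDeriv, HahnSeries.coeff_add, coeff_toL_natCast, PowerSeries.coeff_mk]
    split_ifs
    · rw [HahnSeries.coeff_single_of_ne (by omega), add_zero]
    · exact add_zero _
  · have hk := k.pos
    simp only [coeff_actionL_neg]
    rw [timeDeriv, HahnSeries.coeff_add, coeff_toL_of_neg _ (by omega), zero_add]
    have e : (fun τ : ℂ => (x + tDir j a τ).2 (k, b)) =
        fun τ => x.2 (k, b) + if j = k ∧ a = b then τ else 0 := by
      funext τ
      simp [tDir, Finsupp.single_apply]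
    rw [e]
    by_cases hba : b = a
    · subst hba
      by_cases hjk : j = k
      · subst hjk
        simpa using (hasDerivAt_id (0 : ℂ)).const_add (x.2 (j, b))
      · have hne : -(k : ℤ) ≠ -(j : ℤ) := fun h => hjk (PNat.coe_injective (by omega))
        rw [if_pos rfl, HahnSeries.coeff_single_of_ne hne]
        simpa [hjk] using hasDerivAt_const (0 : ℂ) (x.2 (k, b))
    · rw [if_neg hba]
      simpa [Ne.symm hba] using hasDerivAt_const (0 : ℂ) (x.2 (k, b))

theorem coeff_neg_timeDeriv (g : Idx N → ℕ → Point N → ℂ) (j : ℕ+) (a : Idx N) (x : Point N) :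
    (timeDeriv g j a x a).coeff (-(j : ℤ)) = 1 := by
  have := j.pos
  rw [timeDeriv, if_pos rfl, HahnSeries.coeff_add, coeff_toL_of_neg _ (by omega),
    HahnSeries.coeff_single_same, zero_add]

/-! ### Derivatives along the charge preserving directions -/

theorem hop_add_hop (a b c : Idx N) : hop a b + hop b c = hop a c := by
  simp [hop]

theorem coeff_expDeriv (g : Idx N → ℕ → Point N → ℂ) (v : Idx N → ℤ) (b : Idx N) (x : Point N)
    (i : ℤ) : (expDeriv g v b x).coeff i =
      (toL (expSeries (PowerSeries.mk fun i => lineDeriv ℝ (g b i) x (sDir v)))).coeff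
        (i + v b) := by
  rw [expDeriv, coeff_single_mul, sub_neg_eq_add]

theorem coeff_neg_expDeriv (g : Idx N → ℕ → Point N → ℂ) (v : Idx N → ℤ) (b : Idx N)
    (x : Point N) : (expDeriv g v b x).coeff (-v b) =
      Complex.exp (lineDeriv ℝ (g b 0) x (sDir v)) := by
  rw [coeff_expDeriv, neg_add_cancel, ← Nat.cast_zero, coeff_toL_natCast,
    PowerSeries.coeff_zero_eq_constantCoeff_apply, constantCoeff_expSeries,
    ← PowerSeries.coeff_zero_eq_constantCoeff_apply, PowerSeries.coeff_mk]

theorem expDeriv_ne_zero (g : Idx N → ℕ → Point N → ℂ) (v : Idx N → ℤ) (b : Idx N)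
    (x : Point N) : expDeriv g v b x ≠ 0 := by
  intro h
  have := coeff_neg_expDeriv g v b x
  rw [h] at this
  exact Complex.exp_ne_zero _ this.symm

theorem hop_apply_left {a b : Idx N} (h : a ≠ b) : hop b a a = -1 := by
  simp [hop, h]

theorem hop_apply_other {a b c : Idx N} (h : c ≠ a) (h' : c ≠ b) : hop a b c = 0 := by
  simp [hop, h, h']

section

variable {D : Set (Point N)} (hD : IsDomainZeroCharge D) {g : Idx N → ℕ → Point N → ℂ}
  (hg : ∀ b i, SliceC1 D (g b i)) {x : Point N} (hx : x ∈ D)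

include hD hg hx

theorem expDeriv_hop_mul (a b c e : Idx N) :
    expDeriv g (hop a b) e x * expDeriv g (hop b c) e x = expDeriv g (hop a c) e x := by
  have h : (PowerSeries.mk fun i => lineDeriv ℝ (g e i) x (sDir (hop a c))) =
      (PowerSeries.mk fun i => lineDeriv ℝ (g e i) x (sDir (hop a b))) +
        PowerSeries.mk fun i => lineDeriv ℝ (g e i) x (sDir (hop b c)) := by
    ext i
    rw [map_add, PowerSeries.coeff_mk, PowerSeries.coeff_mk, PowerSeries.coeff_mk,
      ← hop_add_hop a b c, sDir_add,
      (hg e i).lineDeriv_add hD hx (charge_sDir_hop a b) (charge_sDir_hop b c)]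
  rw [expDeriv, expDeriv, expDeriv, h, expSeries_add, toL_mul, ← hop_add_hop a b c, Pi.add_apply,
    neg_add, ← single_mul_single']
  ring

theorem expDeriv_hop_inv (a b e : Idx N) :
    expDeriv g (hop a b) e x = (expDeriv g (hop b a) e x)⁻¹ := by
  have h1 := expDeriv_hop_mul hD hg hx a b a e
  have h2 := expDeriv_hop_mul hD hg hx a a a e
  have h3 := expDeriv_ne_zero g (hop a a) e x
  rw [mul_eq_left₀ h3] at h2
  rw [h2] at h1
  exact eq_inv_of_mul_eq_one_left h1

theorem lineDeriv_eq_zero (b : Idx N) (i : ℕ) (h0 : ∀ y ∈ D, g b i y = 0) {v : Point N}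
    (hv : charge v = 0) : lineDeriv ℝ (g b i) x v = 0 := by
  have h1 : HasDerivAt (fun t : ℝ => g b i (x + t • v)) _ 0 :=
    (hg b i).hasLineDerivAt_lineDeriv hD hx hv
  refine h1.unique ((hasDerivAt_const (0 : ℝ) (0 : ℂ)).congr_of_eventuallyEq ?_)
  filter_upwards [eventually_line_mem hD hx hv] with t ht
  exact h0 _ ht

end

/-! ### The Orlov–Schulman functions -/

theorem exists_zDerivAction_eq (g : Idx N → ℕ → Point N → ℂ) (n₀ : ℝ) (a : Idx N) (x : Point N) :
    ∃ M : PowerSeries ℂ, PowerSeries.constantCoeff M = 0 ∧ zDerivAction g n₀ a x =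
      cst ((n₀ + sg a * x.1 a : ℝ) : ℂ) + cst (sg a : ℂ) * (x.2.sum fun jb c =>
        if jb.2 = a then cst (((jb.1 : ℕ) : ℂ) * c) * HahnSeries.single (-(jb.1 : ℤ)) (1 : ℂ)
        else 0) + toL M := by
  refine ⟨-PowerSeries.C (sg a : ℂ) * PowerSeries.mk fun i => (i : ℂ) * g a i x, ?_, ?_⟩
  · rw [map_mul, ← PowerSeries.coeff_zero_eq_constantCoeff_apply (PowerSeries.mk _),
      PowerSeries.coeff_mk]
    simp
  -- The Euler operator multiplies the coefficient of `w^i` by `i`; it annihilates the constant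
  -- term, so the regular remainder starts at order `1`.
  · have h : HahnSeries.single (1 : ℤ) (1 : ℂ) * LaurentSeries.hasseDeriv ℂ 1 (actionL g a x) =
        -(x.2.sum fun jb c => if jb.2 = a then
          cst (((jb.1 : ℕ) : ℂ) * c) * HahnSeries.single (-(jb.1 : ℤ)) (1 : ℂ) else 0) +
        toL (PowerSeries.mk fun i => (i : ℂ) * g a i x) := by
      ext i
      rw [coeff_single_mul_hasseDeriv, HahnSeries.coeff_add, HahnSeries.coeff_neg, actionL,
        HahnSeries.coeff_add, mul_add, coeff_finsupp_sum, coeff_finsupp_sum, Finsupp.mul_sum]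
      congr 1
      · rw [Finsupp.sum, Finsupp.sum, ← Finset.sum_neg_distrib]
        refine Finset.sum_congr rfl fun jb _ => ?_
        split_ifs
        · rw [coeff_cst_mul]
          by_cases hi : i = -(jb.1 : ℤ)
          · subst hi
            rw [HahnSeries.coeff_single_same, HahnSeries.coeff_single_same]
            push_cast
            ring
          · rw [HahnSeries.coeff_single_of_ne hi, HahnSeries.coeff_single_of_ne hi]
            simp
        · simp
      · rcases lt_or_ge i 0 with hi | hi
        · rw [coeff_toL_of_neg _ hi, coeff_toL_of_neg _ hi, mul_zero]
        · lift i to ℕ using hi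
          rw [coeff_toL_natCast, coeff_toL_natCast, PowerSeries.coeff_mk, PowerSeries.coeff_mk]
          simp
    rw [zDerivAction, h, toL_mul, ← map_neg, toL_C, cst_neg]
    ring

end
end TodaWhitham

namespace TodaWhitham
noncomputable section

variable {N : ℕ} [NeZero N]

/-! ### The functions `r_a` -/

section

variable {E : Set ℝ} (hEpos : ∀ ε ∈ E, 0 < ε) (hE : (𝓝[E] (0 : ℝ)).NeBot) {D : Set (Point N)}
  (hD : IsDomainZeroCharge D) {n : ℝ → ℤ} {S Sb : ℝ → Point N → Op N}
  (hS : ∀ ε ∈ E, IsTodaSolution ε D (S ε) (Sb ε)) {act : Idx N → ℕ → ℝ → Point N → ℂ}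
  {act₀ : Idx N → ℕ → Point N → ℂ} (hact : IsQuasiClassical E D n S Sb act act₀)
  {x : Point N} (hx : x ∈ D)

include hE hD hact in
theorem limit_normalized {y : Point N} (hy : y ∈ D) : act₀ (one N) 0 y = 0 := by
  have h := (hact.tendsto (one N) 0 y 1 ![0] (hD.charge_eq y hy)
    (charge_vec_one (by simp [charge]))).tendsto_at
    (show (0 : Fin 1 → ℝ) ∈ {τ | slice y ![0] τ ∈ D} by simpa [slice_zero] using hy)
  simp only [slice_zero] at h
  refine tendsto_nhds_unique h (tendsto_const_nhds.congr' ?_)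
  filter_upwards [self_mem_nhdsWithin] with ε hε
  exact (hact.normalized ε hε y hy).symm

include hE hD hact hx

theorem lineDeriv_limit_one {v : Point N} (hv : charge v = 0) :
    lineDeriv ℝ (act₀ (one N) 0) x v = 0 :=
  lineDeriv_eq_zero hD hact.contDiffOn_limit hx _ _
    (fun _ hy => limit_normalized hE hD hact hy) hv

theorem coeff_zero_timeDeriv_one (j : ℕ+) (a : Idx N) :
    (timeDeriv act₀ j a x (one N)).coeff 0 = 0 := by
  have hj := j.pos
  have h := coeff_toL_natCast (PowerSeries.mk fun i =>
    lineDeriv ℝ (act₀ (one N) i) x (tDir j a 1)) 0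
  rw [PowerSeries.coeff_mk, lineDeriv_limit_one hE hD hact hx (charge_tDir j a 1),
    Nat.cast_zero] at h
  rw [timeDeriv, HahnSeries.coeff_add, h, zero_add]
  split_ifs
  · rw [HahnSeries.coeff_single_of_ne (by omega)]
  · rfl

/-- A direction not involving `s_1` produces no power of `w` at the index `1`, and the constant
coefficient of `𝒮_{1,0}` is identically zero, so its exponential is `1`. -/
theorem coeff_zero_expDeriv_pow_one {v : Idx N → ℤ} (hv : charge (sDir v) = 0)
    (h : v (one N) = 0) (k : ℕ) : (expDeriv act₀ v (one N) x ^ k).coeff 0 = 1 := by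
  rw [expDeriv_pow, h, mul_zero, neg_zero, coeff_single_mul, sub_zero, ← Nat.cast_zero,
    coeff_toL_natCast, PowerSeries.coeff_zero_eq_constantCoeff_apply, constantCoeff_expSeries,
    ← PowerSeries.coeff_zero_eq_constantCoeff_apply, PowerSeries.coeff_mk,
    lineDeriv_limit_one hE hD hact hx hv, mul_zero, Complex.exp_zero]

include hEpos hS

/-- The constant term in `exists_timeDeriv_eq` is fixed by the normalization of `𝒮_{1,0}`. -/
theorem exists_timeDeriv_eq_sub (j : ℕ+) (a a' : Idx N) (haa' : a ≠ a') (ha : a ≠ one N) :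
    ∃ c : ℕ → ℂ, ∀ b, timeDeriv act₀ j a x b =
      ∑ i ∈ Finset.Icc 1 (j : ℕ), cst (c i) *
        (expDeriv act₀ (hop a a') b x ^ i - if a' = one N then 0 else 1) := by
  obtain ⟨c, c₀, h⟩ := exists_timeDeriv_eq hEpos hE hD hS hact hx j a a' haa'
  refine ⟨c, fun b => ?_⟩
  have h0 := congrArg (fun F => HahnSeries.coeff F 0) (h (one N))
  simp only [coeff_zero_timeDeriv_one hE hD hact hx, HahnSeries.coeff_add, HahnSeries.coeff_sum,
    coeff_cst_mul, coeff_cst_zero] at h0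
  split_ifs with ha'
  · subst ha'
    -- With `a' = 1` each positive power vanishes at the index `1`, hence `c₀ = 0`; in the other
    -- case each power has constant term `1` there and `c₀` is minus the sum of the coefficients.
    have hz : ∑ i ∈ Finset.Icc 1 (j : ℕ),
        c i * (expDeriv act₀ (hop a (one N)) (one N) x ^ i).coeff 0 = 0 := by
      refine Finset.sum_eq_zero fun i hi => ?_
      have := (Finset.mem_Icc.1 hi).1
      rw [expDeriv_pow, coeff_single_mul, hop_apply_left (Ne.symm ha),
        coeff_toL_of_neg _ (by omega), mul_zero]
    rw [hz, zero_add] at h0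
    rw [h b, ← h0, cst_zero, add_zero]
    simp
  · have hz : ∑ i ∈ Finset.Icc 1 (j : ℕ),
        c i * (expDeriv act₀ (hop a a') (one N) x ^ i).coeff 0 =
          ∑ i ∈ Finset.Icc 1 (j : ℕ), c i := by
      refine Finset.sum_congr rfl fun i _ => ?_
      rw [coeff_zero_expDeriv_pow_one hE hD hact hx (charge_sDir_hop a a')
        (hop_apply_other (Ne.symm ha) (Ne.symm ha')), mul_one]
    rw [hz] at h0
    have hc₀ : c₀ = -∑ i ∈ Finset.Icc 1 (j : ℕ), c i := by linear_combination -h0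
    rw [h b, hc₀, cst_neg, cst_sum, ← sub_eq_add_neg, ← Finset.sum_sub_distrib]
    simp only [mul_sub, mul_one]

/-- For `j = 1` the polynomial is linear. Its coefficient cannot vanish, because `∂_{1,1̄}𝒮_{1̄,0}`
has a pole with coefficient `1`. -/
theorem exists_first_time_eq (a : Idx N) (ha : a ≠ oneBar N) : ∃ r : ℂ, r ≠ 0 ∧
    ∀ b, timeDeriv act₀ 1 (oneBar N) x b =
      cst r * (expDeriv act₀ (hop (oneBar N) a) b x - if a = one N then 0 else 1) := by
  obtain ⟨c, h⟩ := exists_timeDeriv_eq_sub hEpos hE hD hS hact hx 1 (oneBar N) a (Ne.symm ha)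
    one_ne_oneBar.symm
  simp only [PNat.one_coe, Finset.Icc_self, Finset.sum_singleton, pow_one] at h
  refine ⟨c 1, ?_, h⟩
  intro h0
  have h1 := coeff_neg_timeDeriv act₀ 1 (oneBar N) x
  rw [h, h0, cst_zero, zero_mul] at h1
  exact zero_ne_one h1

end

/-! ### The structure of the dispersionless functions at a point -/

/-- The functions `exp (∂_v 𝒮_{b,0})` along charge preserving directions form a multiplicative
family, and `∂_x 𝒮_{b,0} = log P_b` determines them through the punctures. -/
structure IsPunctureData (g : Idx N → ℕ → Point N → ℂ) (x : Point N) (ρ : Idx N → ℂ) : Prop where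
  mul : ∀ a b c e, expDeriv g (hop a b) e x * expDeriv g (hop b c) e x = expDeriv g (hop a c) e x
  inv : ∀ a b e, expDeriv g (hop a b) e x = (expDeriv g (hop b a) e x)⁻¹
  ne_zero : ∀ a, a ≠ one N → a ≠ oneBar N → ρ a ≠ 0
  sub_puncture : ∀ a, a ≠ one N → ∀ b, expDeriv g (hop (one N) a) b x =
    expDeriv g (hop (one N) (oneBar N)) b x - cst (puncture ρ a)
  normalized : ∀ v, charge v = 0 → lineDeriv ℝ (g (one N) 0) x v = 0

namespace IsPunctureData

variable {g : Idx N → ℕ → Point N → ℂ} {x : Point N} {ρ : Idx N → ℂ} (h : IsPunctureData g x ρ)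

include h

theorem sub_puncture_ne {a : Idx N} (ha : a ≠ one N) (b : Idx N) :
    expDeriv g (hop (one N) (oneBar N)) b x - cst (puncture ρ a) ≠ 0 := by
  rw [← h.sub_puncture a ha b]
  exact expDeriv_ne_zero _ _ _ _

/-- The second index is the reference charge: `1̄` in general, and `1` when `a = 1̄`. With this
choice `Z_a` is the exponential derivative that has a simple pole at the puncture `a`. -/
theorem expDeriv_eq_zFun (a b : Idx N) :
    expDeriv g (hop a (if a = oneBar N then one N else oneBar N)) b x =
      zFun ρ a (expDeriv g (hop (one N) (oneBar N)) b x) := by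
  by_cases h1 : a = one N
  · subst h1
    rw [if_neg one_ne_oneBar, zFun, if_pos rfl]
  by_cases h2 : a = oneBar N
  · subst h2
    rw [if_pos rfl, zFun, if_neg h1, if_pos rfl, h.inv]
  · rw [if_neg h2, zFun, if_neg h1, if_neg h2, ← h.mul a (one N) (oneBar N), h.inv a (one N),
      h.sub_puncture a h1, puncture, if_neg h2, cst_neg, sub_neg_eq_add, div_eq_mul_inv, mul_comm]

/-- Look at the local expansion at `b`: there `P - q_b` has a simple zero while `P - q_a` has a
nonzero constant term. -/
theorem puncture_ne {a b : Idx N} (ha : a ≠ one N) (hb : b ≠ one N) (hab : a ≠ b) :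
    puncture ρ a ≠ puncture ρ b := by
  intro he
  have h1 := h.sub_puncture a ha b
  rw [he, ← h.sub_puncture b hb b] at h1
  have h2 := congrArg (fun F => HahnSeries.coeff F 0) h1
  have h3 := coeff_neg_expDeriv g (hop (one N) a) b x
  rw [hop_apply_other hb (Ne.symm hab), neg_zero] at h3
  simp only [h3, coeff_expDeriv, hop_apply_left hb] at h2
  rw [coeff_toL_of_neg _ (by omega)] at h2
  exact Complex.exp_ne_zero _ h2

/-- The dispersionless Lax functions. -/
theorem exists_lax (a : Idx N) : ∃ f : PowerSeries ℂ, IsLaxFunction g ρ a x f ∧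
    PowerSeries.coeff 1 f ≠ 0 ∧ (a = one N → PowerSeries.coeff 1 f = 1) ∧
    ∀ f', IsLaxFunction g ρ a x f' → f' = f := by
  -- The direction is chosen with `v_a = -1`, so that `Q` is a local parameter in `w`: it represents
  -- `1/P` for `a = 1` and `P - q_a` otherwise.
  let v := hop (if a = one N then oneBar N else one N) a
  have hv : v a = -1 := by
    refine hop_apply_left ?_
    split_ifs with ha
    · rw [ha]; exact one_ne_oneBar
    · exact ha
  let U := expSeries (PowerSeries.mk fun i => lineDeriv ℝ (g a i) x (sDir v))
  let Q := PowerSeries.X * U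
  have hQ : toL Q = expDeriv g v a x := by
    rw [expDeriv, hv, neg_neg, toL_mul, toL_X]
  have hQ0 : PowerSeries.constantCoeff Q = 0 := by simp [Q]
  have hQ1 : PowerSeries.coeff 1 Q = Complex.exp (lineDeriv ℝ (g a 0) x (sDir v)) := by
    rw [show (1 : ℕ) = 0 + 1 from rfl, PowerSeries.coeff_succ_X_mul,
      PowerSeries.coeff_zero_eq_constantCoeff_apply, constantCoeff_expSeries,
      ← PowerSeries.coeff_zero_eq_constantCoeff_apply, PowerSeries.coeff_mk]
  have hQ1' : PowerSeries.coeff 1 Q ≠ 0 := by rw [hQ1]; exact Complex.exp_ne_zero _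
  -- For nonzero `f`, the Lax equation says exactly that `f` is the compositional inverse of `Q`,
  -- which gives existence and uniqueness together.
  have key : ∀ f (hf : PowerSeries.constantCoeff f = 0) (hf0 : f ≠ 0),
      compL (expDeriv g (hop (one N) (oneBar N)) a x) f = pLocal a (puncture ρ a) ↔
        Q.subst f = PowerSeries.X := by
    intro f hf hf0
    have h1 : Q.subst f = PowerSeries.X ↔ compHom f hf hf0 (expDeriv g v a x) =
        HahnSeries.single (1 : ℤ) (1 : ℂ) := by
      rw [← hQ, compHom_apply, compL_toL hf hf0, ← toL_X]
      exact ⟨fun h => congrArg toL h, fun h => toL_injective h⟩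
    rw [h1, ← compHom_apply f hf hf0]
    by_cases ha : a = one N
    · simp only [v, if_pos ha]
      subst ha
      rw [h.inv (oneBar N) (one N), map_inv₀, pLocal, if_pos rfl, ← single_one_inv,
        inv_eq_iff_eq_inv]
    · simp only [v, if_neg ha]
      rw [h.sub_puncture a ha, map_sub, compHom_apply f hf hf0 (cst _), compL_cst hf hf0, pLocal,
        if_neg ha, sub_eq_iff_eq_add']
  have hu : IsUnit (PowerSeries.coeff 1 Q) := hQ1'.isUnit
  have hf0 : PowerSeries.constantCoeff (Q.substInvOfIsUnit hu) = 0 :=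
    PowerSeries.constantCoeff_substInvOfIsUnit Q hu
  have hf1 : PowerSeries.coeff 1 (Q.substInvOfIsUnit hu) * PowerSeries.coeff 1 Q = 1 := by
    rw [PowerSeries.coeff_one_substInvOfIsUnit]
    exact hu.val_inv_mul
  have hf1' : PowerSeries.coeff 1 (Q.substInvOfIsUnit hu) ≠ 0 := left_ne_zero_of_mul_eq_one hf1
  have hfQ := PowerSeries.subst_substInvOfIsUnit_right Q hQ0 hu
  refine ⟨Q.substInvOfIsUnit hu, ⟨hf0, (key _ hf0 (ne_zero_of_coeff_one hf1')).2 hfQ⟩, hf1', ?_, ?_⟩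
  · rintro rfl
    rw [hQ1, h.normalized _ (charge_sDir_hop _ _), Complex.exp_zero, mul_one] at hf1
    exact hf1
  · rintro f' ⟨h1, h2⟩
    have hne : f' ≠ 0 := by
      rintro rfl
      obtain ⟨m, hm, hm'⟩ := pLocal_coeff_ne a (puncture ρ a)
      rw [← h2, compL_zero_right_coeff _ hm] at hm'
      exact hm' rfl
    exact eq_of_subst_eq_X hQ0 hQ1' hf0 h1 hfQ ((key f' h1 hne).1 h2)

theorem exists_inv_lax_eq {a : Idx N} {f : PowerSeries ℂ} (hf : PowerSeries.constantCoeff f = 0)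
    (hf1 : PowerSeries.coeff 1 f ≠ 0) (hone : a = one N → PowerSeries.coeff 1 f = 1) :
    ∃ (l : ℂ) (k : PowerSeries ℂ), l ≠ 0 ∧ (a = one N → l = 1) ∧
      (toL f)⁻¹ = cst l * zFun ρ a (pLocal a (puncture ρ a)) + toL (k.subst (zInv ρ a)) := by
  have hz := constantCoeff_zInv ρ a
  have hz1 := coeff_one_zInv_ne h.ne_zero a
  obtain ⟨K, hK⟩ := exists_inv_eq hf hf1 hz hz1
  obtain ⟨k, hk, -⟩ := exists_subst_eq hz hz1 K
  refine ⟨_, k, div_ne_zero hz1 hf1, fun ha => ?_, ?_⟩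
  · rw [hone ha, coeff_one_zInv, if_pos (Or.inl ha), div_one]
  · rw [hK, hk, toL_zInv h.ne_zero, inv_inv]

theorem exists_orlovSchulman_eq (n₀ : ℝ) {a : Idx N} {f : PowerSeries ℂ}
    (hf : PowerSeries.constantCoeff f = 0) (hf1 : PowerSeries.coeff 1 f ≠ 0) :
    ∃ μ : PowerSeries ℂ, PowerSeries.constantCoeff μ = 0 ∧
      compL (zDerivAction g n₀ a x) f = cst ((n₀ + sg a * x.1 a : ℝ) : ℂ) +
        cst (sg a : ℂ) * (x.2.sum fun jb c =>
          if jb.2 = a then cst (((jb.1 : ℕ) : ℂ) * c) * toL f ^ (-(jb.1 : ℤ)) else 0) +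
        toL (μ.subst (zInv ρ a)) := by
  have hf0 := ne_zero_of_coeff_one hf1
  obtain ⟨M, hM0, hM⟩ := exists_zDerivAction_eq g n₀ a x
  obtain ⟨μ, hμ, hμ0⟩ := exists_subst_eq (constantCoeff_zInv ρ a)
    (coeff_one_zInv_ne h.ne_zero a) (M.subst f)
  refine ⟨μ, ?_, ?_⟩
  · rw [hμ0, constantCoeff_subst_of_zero hf, hM0]
  · have hc : ∀ c, compHom f hf hf0 (cst c) = cst c := fun c => compL_cst hf hf0 c
    have hs : ∀ m, compHom f hf hf0 (HahnSeries.single m (1 : ℂ)) = toL f ^ m := fun m =>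
      compL_single hf hf0 m
    rw [← compHom_apply f hf hf0, hM, map_add, map_add, map_mul, hc, hc, map_finsuppSum, hμ,
      compHom_apply f hf hf0 (toL M), compL_toL hf hf0]
    congr 4
    funext jb c
    split_ifs
    · rw [map_mul, hc, hs]
    · exact map_zero _

/-- The time derivatives of `𝒮_{b,0}` are the projections of the powers of the Lax functions. -/
theorem exists_projection {j : ℕ+} {a : Idx N} {f : PowerSeries ℂ}
    (hf : IsLaxFunction g ρ a x f) (hf1 : PowerSeries.coeff 1 f ≠ 0) {c : ℕ → ℂ} {c₀ : ℂ}
    (hc : ∀ b, timeDeriv g j a x b =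
      ∑ i ∈ Finset.Icc 1 (j : ℕ), cst (c i) *
        (expDeriv g (hop a (if a = oneBar N then one N else oneBar N)) b x ^ i -
          if a = one N ∨ a = oneBar N then 0 else 1) + if a = one N then cst c₀ else 0) :
    ∃ k : PowerSeries ℂ, toL f ^ (-(j : ℤ)) =
        (∑ i ∈ Finset.Icc 1 (j : ℕ), cst (c i) * zFun ρ a (pLocal a (puncture ρ a)) ^ i) +
          toL (k.subst (zInv ρ a)) ∧
      ∀ b, timeDeriv g j a x b = (∑ i ∈ Finset.Icc 1 (j : ℕ), cst (c i) *
        (zFun ρ a (expDeriv g (hop (one N) (oneBar N)) b x) ^ i -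
          if a = one N ∨ a = oneBar N then 0 else 1)) +
        if a = one N then cst (PowerSeries.constantCoeff k) else 0 := by
  obtain ⟨hf0, hlax⟩ := hf
  have hne := ne_zero_of_coeff_one hf1
  have hcst : ∀ c, compHom f hf0 hne (cst c) = cst c := fun c => compL_cst hf0 hne c
  let A : PowerSeries ℂ := PowerSeries.mk fun i => lineDeriv ℝ (g a i) x (tDir j a 1)
  -- All constants on the right-hand side once the Lax function is substituted; `A` is the regular
  -- part of `∂_{ja}𝒮_{a,0}`, and `d - A∘f` is everything regular in the power of `z_a`.
  let d : ℂ := (if a = one N then c₀ else 0) -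
    ∑ i ∈ Finset.Icc 1 (j : ℕ), c i * if a = one N ∨ a = oneBar N then 0 else 1
  obtain ⟨k, hk, hk0⟩ := exists_subst_eq (constantCoeff_zInv ρ a)
    (coeff_one_zInv_ne h.ne_zero a) (PowerSeries.C d - A.subst f)
  refine ⟨k, ?_, fun b => ?_⟩
  · have h1 := congrArg (compHom f hf0 hne) (hc a)
    rw [h.expDeriv_eq_zFun, timeDeriv, if_pos rfl, map_add, map_add, map_sum,
      compHom_apply f hf0 hne (toL _), compL_toL hf0 hne,
      compHom_apply f hf0 hne (HahnSeries.single _ _), compL_single hf0 hne] at h1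
    have h2 : ∀ i, compHom f hf0 hne (cst (c i) *
        (zFun ρ a (expDeriv g (hop (one N) (oneBar N)) a x) ^ i -
          if a = one N ∨ a = oneBar N then 0 else 1)) =
        cst (c i) * zFun ρ a (pLocal a (puncture ρ a)) ^ i -
          cst (c i * if a = one N ∨ a = oneBar N then 0 else 1) := by
      intro i
      rw [map_mul, map_sub, map_pow, map_zFun _ hcst, hcst,
        compHom_apply f hf0 hne (expDeriv _ _ _ _),
        hlax, mul_sub]
      split_ifs <;> simp
    have h3 : compHom f hf0 hne (if a = one N then cst c₀ else 0) =
        cst (if a = one N then c₀ else 0) := by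
      split_ifs
      · exact hcst _
      · rw [map_zero, cst_zero]
    simp only [h2, h3, Finset.sum_sub_distrib] at h1
    have h4 : cst d = cst (if a = one N then c₀ else 0) - ∑ i ∈ Finset.Icc 1 (j : ℕ),
        cst (c i * if a = one N ∨ a = oneBar N then 0 else 1) := by
      rw [← cst_sum]
      exact map_sub _ _ _
    rw [hk, toL_sub, toL_C, h4]
    linear_combination h1
  · rw [hc b, h.expDeriv_eq_zFun]
    congr 1
    split_ifs with ha
    · congr 1
      -- The normalization of `𝒮_{1,0}` is what makes the constant in the flow equal to the constant
      -- term of `z_1^j`, so that `Ω_{j1}` includes the power `p^0`.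
      have hA : PowerSeries.constantCoeff A = 0 := by
        rw [← PowerSeries.coeff_zero_eq_constantCoeff_apply, PowerSeries.coeff_mk, ha]
        exact h.normalized _ (charge_tDir j (one N) 1)
      rw [hk0, map_sub, constantCoeff_subst_of_zero hf0, hA, sub_zero, PowerSeries.constantCoeff_C]
      simp [d, ha]
    · rfl

end IsPunctureData

end
end TodaWhitham

namespace TodaWhitham
noncomputable section

variable {N : ℕ} [NeZero N]

namespace IsPunctureData

variable {g : Idx N → ℕ → Point N → ℂ} {x : Point N} {ρ : Idx N → ℂ} (h : IsPunctureData g x ρ)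

include h

/-- The equation `∂𝒮_{a,0}/∂t_{0b} = -log (p - q_b)`, exponentiated. -/
theorem exists_charge_flow {D : Set (Point N)} (hD : IsDomainZeroCharge D)
    (hg : ∀ b i, SliceC1 D (g b i)) (hx : x ∈ D) (n₀ : ℝ) (a : Idx N) {b : Idx N}
    (hb : b ≠ one N) : ∃ (c : ℤ) (F : PowerSeries ℂ),
      HasLineDerivAt ℝ (fun y : Point N => ((y.1 a + sg a * n₀ : ℝ) : ℂ)) (c : ℂ) x
        (sDir (hop b (one N))) ∧
      (∀ i : ℤ, HasLineDerivAt ℝ (fun y => (actionL g a y).coeff i) ((toL F).coeff i) x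
        (sDir (hop b (one N)))) ∧
      HahnSeries.single (-c) (1 : ℂ) * toL (expSeries F) =
        (expDeriv g (hop (one N) (oneBar N)) a x - cst (puncture ρ b))⁻¹ := by
  refine ⟨hop b (one N) a,
    PowerSeries.mk fun i => lineDeriv ℝ (g a i) x (sDir (hop b (one N))), ?_, ?_, ?_⟩
  · have h1 : HasDerivAt (fun t : ℝ => x.1 a + t * (hop b (one N) a : ℝ) + sg a * n₀)
        (hop b (one N) a : ℝ) 0 := by
      simpa using (((hasDerivAt_id (0 : ℝ)).mul_const (hop b (one N) a : ℝ)).const_add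
        (x.1 a)).add_const (sg a * n₀ : ℝ)
    have h2 := h1.ofReal_comp
    rw [Complex.ofReal_intCast] at h2
    exact h2
  · intro i
    rcases exists_natCast_or_neg i with ⟨k, rfl⟩ | ⟨k, rfl⟩
    · simp only [coeff_actionL_of_nonneg]
      rw [coeff_toL_natCast, PowerSeries.coeff_mk]
      exact (hg a k).hasLineDerivAt_lineDeriv hD hx (charge_sDir_hop b (one N))
    · have := k.pos
      simp only [coeff_actionL_neg]
      rw [coeff_toL_of_neg _ (by omega)]
      have e : (fun t : ℝ => (x + t • sDir (hop b (one N))).2 (k, a)) = fun _ => x.2 (k, a) := by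
        funext t
        simp [sDir]
      rw [HasLineDerivAt, e]
      exact hasDerivAt_const _ _
  · rw [← h.sub_puncture b hb a, ← h.inv]
    rfl

end IsPunctureData

/-! ### Puncture data of the dispersionless limit -/

section

variable {E : Set ℝ} (hEpos : ∀ ε ∈ E, 0 < ε) (hE : (𝓝[E] (0 : ℝ)).NeBot) {D : Set (Point N)}
  (hD : IsDomainZeroCharge D) {n : ℝ → ℤ} {S Sb : ℝ → Point N → Op N}
  (hS : ∀ ε ∈ E, IsTodaSolution ε D (S ε) (Sb ε)) {act : Idx N → ℕ → ℝ → Point N → ℂ}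
  {act₀ : Idx N → ℕ → Point N → ℂ} (hact : IsQuasiClassical E D n S Sb act act₀)
  {x : Point N} (hx : x ∈ D)

include hEpos hE hD hS hact hx

theorem hasTimeDeriv_limit (j : ℕ+) (a b : Idx N) :
    HasTimeDeriv (actionL act₀ b) (timeDeriv act₀ j a x b) j a x :=
  hasTimeDeriv_actionL fun i => SliceC1.hasDerivAt_time hD hx (hact.contDiffOn_limit b i) fun τ =>
    lineDeriv_limit_tDir hEpos hE hD hS hact hx j a τ b i

/-- The same derivative `∂_{1,1̄}𝒮_{b,0}` equals `r_1/P` and `r_a (exp((∂_{1̄} - ∂_a)𝒮_b) - 1)`.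
Solving for the exponential and multiplying by `P` gives `P + ρ_a`, the relation that locates the
punctures. -/
theorem exists_isPunctureData : ∃ r ρ : Idx N → ℂ,
    (∀ a, a ≠ oneBar N → r a ≠ 0 ∧ ρ a = r (one N) / r a) ∧
    (∀ a, a ≠ oneBar N → ∀ b, timeDeriv act₀ 1 (oneBar N) x b =
      cst (r a) * (expDeriv act₀ (hop (oneBar N) a) b x - if a = one N then 0 else 1)) ∧
    IsPunctureData act₀ x ρ := by
  have hr' : ∀ a, ∃ r : ℂ, a ≠ oneBar N → r ≠ 0 ∧ ∀ b, timeDeriv act₀ 1 (oneBar N) x b =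
      cst r * (expDeriv act₀ (hop (oneBar N) a) b x - if a = one N then 0 else 1) := by
    intro a
    by_cases ha : a = oneBar N
    · exact ⟨0, fun h => absurd ha h⟩
    · obtain ⟨r, hr⟩ := exists_first_time_eq hEpos hE hD hS hact hx a ha
      exact ⟨r, fun _ => hr⟩
  choose r hr using hr'
  have hmul := expDeriv_hop_mul hD hact.contDiffOn_limit hx
  have hinv := expDeriv_hop_inv hD hact.contDiffOn_limit hx
  have hr1 := hr (one N) one_ne_oneBar
  refine ⟨r, fun a => r (one N) / r a, fun a ha => ⟨(hr a ha).1, rfl⟩, fun a ha => (hr a ha).2,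
    hmul, hinv, fun a _ h2 => div_ne_zero hr1.1 (hr a h2).1, fun a h1 b => ?_,
    fun v hv => lineDeriv_limit_one hE hD hact hx hv⟩
  by_cases h2 : a = oneBar N
  · rw [puncture, if_pos h2, cst_zero, sub_zero, h2]
  · rw [puncture, if_neg h2, cst_neg, sub_neg_eq_add]
    have e1 := hr1.2 b
    have e2 := (hr a h2).2 b
    rw [if_pos rfl, sub_zero] at e1
    rw [if_neg h1, e1] at e2
    have hP := expDeriv_ne_zero act₀ (hop (one N) (oneBar N)) b x
    have hra : cst (r a) ≠ 0 := fun h0 => (hr a h2).1 (by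
      have := congrArg (fun F => HahnSeries.coeff F 0) h0
      simpa [coeff_cst_zero] using this)
    have e3 : cst (r (one N) / r a) * cst (r a) = cst (r (one N)) := by
      rw [← map_mul, div_mul_cancel₀ _ (hr a h2).1]
    rw [← hmul (one N) (oneBar N) a b]
    rw [hinv (oneBar N) (one N), ← e3] at e2
    have e4 : cst (r (one N) / r a) * (expDeriv act₀ (hop (one N) (oneBar N)) b x)⁻¹ =
        expDeriv act₀ (hop (oneBar N) a) b x - 1 := by
      refine mul_left_cancel₀ hra ?_
      rw [← e2]
      ring
    rw [eq_sub_iff_add_eq] at e4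
    rw [← e4]
    field_simp
    ring

/-- Puts the three kinds of puncture in one shape, with the reference charge chosen so that the
powers are those of `Z_a`. For `a = 1` the constant stays free here and is identified in
`exists_projection`. -/
theorem exists_coefficients (j : ℕ+) (a : Idx N) : ∃ (c : ℕ → ℂ) (c₀ : ℂ), ∀ b,
    timeDeriv act₀ j a x b = ∑ i ∈ Finset.Icc 1 (j : ℕ), cst (c i) *
      (expDeriv act₀ (hop a (if a = oneBar N then one N else oneBar N)) b x ^ i -
        if a = one N ∨ a = oneBar N then 0 else 1) + if a = one N then cst c₀ else 0 := by
  by_cases h1 : a = one N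
  · subst h1
    obtain ⟨c, c₀, h⟩ := exists_timeDeriv_eq hEpos hE hD hS hact hx j (one N) (oneBar N)
      one_ne_oneBar
    refine ⟨c, c₀, fun b => ?_⟩
    rw [h b, if_neg one_ne_oneBar, if_pos (Or.inl rfl), if_pos rfl]
    simp only [sub_zero]
  · obtain ⟨c, h⟩ := exists_timeDeriv_eq_sub hEpos hE hD hS hact hx j a
      (if a = oneBar N then one N else oneBar N)
      (by split_ifs with h2 <;> assumption) h1
    refine ⟨c, 0, fun b => ?_⟩
    rw [h b, if_neg h1, add_zero]
    by_cases h2 : a = oneBar N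
    · simp [h2]
    · simp [h1, h2, one_ne_oneBar.symm]

end

end
end TodaWhitham

/-! ### Assembly of the proposition -/

open TodaWhitham in
theorem mainTheorem10 (N : ℕ) [NeZero N] (E : Set ℝ) (hEpos : ∀ ε ∈ E, 0 < ε)
    (hE : (𝓝[E] (0 : ℝ)).NeBot) (D : Set (Point N)) (hD : IsDomainZeroCharge D)
    (n : ℝ → ℤ) (n₀ : ℝ) (hn : Tendsto (fun ε : ℝ => ε * (n ε : ℝ)) (𝓝[E] 0) (𝓝 n₀))
    (S Sb : ℝ → Point N → Op N) (hS : ∀ ε ∈ E, IsTodaSolution ε D (S ε) (Sb ε))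
    (act : Idx N → ℕ → ℝ → Point N → ℂ) (act₀ : Idx N → ℕ → Point N → ℂ)
    (hact : IsQuasiClassical E D n S Sb act act₀) :
    ∃ (r ρ : Idx N → Point N → ℂ) (f : Idx N → Point N → PowerSeries ℂ),
      -- the functions `r_a` and `ρ_a = r_1 / r_a`
      (∀ x ∈ D, ∀ a, a ≠ oneBar N → r a x ≠ 0 ∧ ρ a x = r (one N) x / r a x) ∧
      (∀ x ∈ D, ∀ b, ∃ F : LaurentSeries ℂ, HasTimeDeriv (actionL act₀ b) F 1 (oneBar N) x ∧
        F = cst (r (one N) x) * expDeriv act₀ (hop (oneBar N) (one N)) b x ∧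
        ∀ a, a ≠ one N → a ≠ oneBar N →
          F = cst (r a x) * (expDeriv act₀ (hop (oneBar N) a) b x - 1)) ∧
      -- the Lax functions `z_a`, with `f_a = z_a^{- sg a}`, are well defined
      (∀ x ∈ D, ∀ a, IsLaxFunction act₀ (fun b => ρ b x) a x (f a x) ∧
        ∀ f', IsLaxFunction act₀ (fun b => ρ b x) a x f' → f' = f a x) ∧
      -- `z_a^{sg a} = ℓ_{a,1} Z_a + ℓ_{a,0} + O(Z_a⁻¹)`
      (∀ x ∈ D, ∀ a, ∃ (ℓ : ℂ) (h : PowerSeries ℂ), ℓ ≠ 0 ∧ (a = one N → ℓ = 1) ∧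
        (toL (f a x))⁻¹ =
          cst ℓ * zFun (fun b => ρ b x) a (pLocal a (puncture (fun b => ρ b x) a)) +
            toL (h.subst (zInv (fun b => ρ b x) a))) ∧
      -- `m_a = n₀ + sg a (s_a + ∑ j t_{ja} z_a^{sg a j}) + ∑ μ_{aj} Z_a^{-j}`
      (∀ x ∈ D, ∀ a, ∃ μ : PowerSeries ℂ, PowerSeries.constantCoeff μ = 0 ∧
        compL (zDerivAction act₀ n₀ a x) (f a x) =
          cst ((n₀ + sg a * x.1 a : ℝ) : ℂ) +
            cst (sg a : ℂ) * (x.2.sum fun jb c =>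
              if jb.2 = a then cst (((jb.1 : ℕ) : ℂ) * c) * toL (f a x) ^ (-(jb.1 : ℤ)) else 0) +
            toL (μ.subst (zInv (fun b => ρ b x) a))) ∧
      -- `∂_a 𝒮_{b,0} = log (p / (p + ρ_a))` for `a ≠ 1, 1̄`, where `log p = ∂_x 𝒮_{b,0}`
      (∀ x ∈ D, ∀ a b, a ≠ one N → a ≠ oneBar N →
        expDeriv act₀ (hop a (oneBar N)) b x =
          zFun (fun c => ρ c x) a (expDeriv act₀ (hop (one N) (oneBar N)) b x)) ∧
      -- `∂_{ja} 𝒮_{b,0} = Ω_{ja}`, the projection of `z_a^{sg a j}`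
      (∀ x ∈ D, ∀ (j : ℕ+) (a : Idx N), ∃ (c : ℕ → ℂ) (h : PowerSeries ℂ),
        toL (f a x) ^ (-(j : ℤ)) =
          (∑ i ∈ Finset.Icc 1 (j : ℕ), cst (c i) *
            zFun (fun b => ρ b x) a (pLocal a (puncture (fun b => ρ b x) a)) ^ i) +
            toL (h.subst (zInv (fun b => ρ b x) a)) ∧
        ∀ b, HasTimeDeriv (actionL act₀ b)
          ((∑ i ∈ Finset.Icc 1 (j : ℕ), cst (c i) *
            (zFun (fun b => ρ b x) a (expDeriv act₀ (hop (one N) (oneBar N)) b x) ^ i -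
              if a = one N ∨ a = oneBar N then 0 else 1)) +
            if a = one N then cst (PowerSeries.constantCoeff h) else 0) j a x) ∧
      -- the functions `𝒮_{b,0}` give a solution of the Whitham hierarchy in the Toda picture
      IsWhithamToda D (fun a x => puncture (fun b => ρ b x) a) f
        (fun a x => ((x.1 a + sg a * n₀ : ℝ) : ℂ)) (actionL act₀) := by
  -- The data are constructed separately at each point; outside `D` they are set to zero so that
  -- `choose` yields functions on the whole space.
  have key : ∀ x, ∃ (r ρ : Idx N → ℂ) (f : Idx N → PowerSeries ℂ), x ∈ D →
      (∀ a, a ≠ oneBar N → r a ≠ 0 ∧ ρ a = r (one N) / r a) ∧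
      (∀ a, a ≠ oneBar N → ∀ b, timeDeriv act₀ 1 (oneBar N) x b =
        cst (r a) * (expDeriv act₀ (hop (oneBar N) a) b x - if a = one N then 0 else 1)) ∧
      IsPunctureData act₀ x ρ ∧
      ∀ a, IsLaxFunction act₀ ρ a x (f a) ∧ PowerSeries.coeff 1 (f a) ≠ 0 ∧
        (a = one N → PowerSeries.coeff 1 (f a) = 1) ∧
        ∀ f', IsLaxFunction act₀ ρ a x f' → f' = f a := by
    intro x
    by_cases hx : x ∈ D
    · obtain ⟨r, ρ, h1, h2, h3⟩ := exists_isPunctureData hEpos hE hD hS hact hx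
      choose f hf using h3.exists_lax
      exact ⟨r, ρ, f, fun _ => ⟨h1, h2, h3, hf⟩⟩
    · exact ⟨0, 0, 0, fun h => absurd h hx⟩
  choose r ρ f hkey using key
  have hr := fun x hx => (hkey x hx).1
  have htime := fun x hx => (hkey x hx).2.1
  have hdata := fun x hx => (hkey x hx).2.2.1
  have hlax := fun x hx => (hkey x hx).2.2.2
  have hproj : ∀ x ∈ D, ∀ (j : ℕ+) (a : Idx N), ∃ (c : ℕ → ℂ) (k : PowerSeries ℂ),
      toL (f x a) ^ (-(j : ℤ)) = (∑ i ∈ Finset.Icc 1 (j : ℕ), cst (c i) *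
        zFun (ρ x) a (pLocal a (puncture (ρ x) a)) ^ i) + toL (k.subst (zInv (ρ x) a)) ∧
      ∀ b, HasTimeDeriv (actionL act₀ b) ((∑ i ∈ Finset.Icc 1 (j : ℕ), cst (c i) *
        (zFun (ρ x) a (expDeriv act₀ (hop (one N) (oneBar N)) b x) ^ i -
          if a = one N ∨ a = oneBar N then 0 else 1)) +
        if a = one N then cst (PowerSeries.constantCoeff k) else 0) j a x := by
    intro x hx j a
    obtain ⟨c, c₀, hc⟩ := exists_coefficients hEpos hE hD hS hact hx j a
    obtain ⟨k, hk, ht⟩ := (hdata x hx).exists_projection (hlax x hx a).1 (hlax x hx a).2.1 hc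
    refine ⟨c, k, hk, fun b => ?_⟩
    rw [← ht b]
    exact hasTimeDeriv_limit hEpos hE hD hS hact hx j a b
  refine ⟨fun a x => r x a, fun a x => ρ x a, fun a x => f x a, hr, ?_, ?_, ?_, ?_, ?_, hproj, ?_⟩
  · intro x hx b
    refine ⟨_, hasTimeDeriv_limit hEpos hE hD hS hact hx 1 (oneBar N) b, ?_, fun a h1 h2 => ?_⟩
    · rw [htime x hx (one N) one_ne_oneBar b, if_pos rfl, sub_zero]
    · rw [htime x hx a h2 b, if_neg h1]
  · exact fun x hx a => ⟨(hlax x hx a).1, (hlax x hx a).2.2.2⟩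
  · exact fun x hx a => (hdata x hx).exists_inv_lax_eq (hlax x hx a).1.1 (hlax x hx a).2.1
      (hlax x hx a).2.2.1
  · exact fun x hx a => (hdata x hx).exists_orlovSchulman_eq n₀ (hlax x hx a).1.1
      (hlax x hx a).2.1
  · intro x hx a b _ h2
    have := (hdata x hx).expDeriv_eq_zFun a b
    rwa [if_neg h2] at this
  · refine ⟨fun x _ => if_pos rfl, fun x hx a b ha hb hab => (hdata x hx).puncture_ne ha hb hab,
      fun x hx a => (hlax x hx a).1.1, fun x hx a => (hlax x hx a).2.1,
      fun x hx => (hlax x hx (one N)).2.2.1 rfl, fun x hx a => ?_⟩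
    -- The inverse function `p(z_a)` is `exp(∂_x 𝒮_{a,0})` itself, and its required composition with
    -- the Lax function is the defining equation of the latter.
    refine ⟨expDeriv act₀ (hop (one N) (oneBar N)) a x, (hlax x hx a).1.2, fun j b => ⟨?_, ?_⟩,
      fun b hb => (hdata x hx).exists_charge_flow hD hact.contDiffOn_limit hx n₀ a hb⟩
    · simpa [tDir] using hasDerivAt_const (0 : ℂ) ((x.1 a + sg a * n₀ : ℝ) : ℂ)
    · obtain ⟨c, k, hk, ht⟩ := hproj x hx j b
      have hω := whithamOmega_eq (ρ x) b (f x b) j c _ hk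
        (fun hb => (hdata x hx).sub_puncture_ne hb a)
      rw [constantCoeff_subst_of_zero (constantCoeff_zInv (ρ x) b)] at hω
      exact hω ▸ ht a
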